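/- Let $d\in\mathbb N$ and let $B=(B_t)_{t\in\mathbb R^d}$, $B_t=(B^{(1)}_t,\dots,B^{(d)}_t)$, be a centered $\mathbb R^d$-valued Gaussian process whose coordinate processes $B^{(1)},\dots,B^{(d)}$ are independent, and which has stationary increments: $B_0=0$ a.s., and for every $t\in\mathbb R^d$ the process $\theta_tB=(B_{x+t}-B_t)_{x\in\mathbb R^d}$ has the same law as $B$. Let $\Sigma_t=\operatorname{Cov}(B_t)=\operatorname{Diag}(v_1(t),\dots,v_d(t))$ be its variogram, and assume that $B$ has no drift and Lévy measures $\mu_1,\dots,\mu_d$, that is, for $1\le i\le d$, $$v_i(t)=\int_{\mathbb R^d}\bigl|1-e^{-i\langle t,x\rangle}\bigr|^2\,\mu_i(\mathrm dx),\qquad t\in\mathbb R^d,$$ where $\mu_i$ is a symmetric Borel measure on $\mathbb R^d$ with $\mu_i(\{0\})=0$ and $\int(1\wedge\|x\|^2)\,\mu_i(\mathrm dx)<\infty$. Events below are sets $A$ of paths $w:\mathbb R^d\to\mathbb R^d$ belonging to the product $\sigma$-algebra; $\theta_t$ acts on paths by $(\theta_tw)(x)=w(x+t)-w(t)$, and $\theta_tA=\{w:\theta_{-t}w\in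 A\}$ (on paths vanishing at $0$ this is the image of $A$ under $\theta_t$). Write $\mathsf B_r$ for the ball of radius $r$ about $0$. The process $B$ is called - ergodic if $\mathbb P(B\in A)\in\{0,1\}$ for every event $A$ which is invariant in the sense that $\mathbb P(B\in\theta_tA\,\triangle\,A)=0$ for each $t\in\mathbb R^d$; - weakly mixing if $\frac1{\operatorname{Vol}(\mathsf B_r)}\int_{\mathsf B_r}\bigl|\mathbb P(B\in\theta_tA,\,B\in A')-\mathbb P(B\in A)\,\mathbb P(B\in A')\bigr|\,\mathrm dt\to0$ as $r\to\infty$, for all events $A,A'$; - mixing if $\mathbb P(B\in\theta_tA,\,B\in A')\to\mathbb P(B\in A)\,\mathbb P(B\in A')$ as $\|t\|\to\infty$, for all events $A,A'$. Then: 1. $B$ is ergodic if and only if $\mu_i$ is non-atomic for every $1\le i\le d$; and $B$ is weakly mixing if and only if $\mu_i$ is non-atomic for every $1\le i\le d$. In particular, ergodicity and weak mixing of $B$ are equivalent. 2. $B$ is mixing if and only if, for all $a,b\in\mathbb R^d$, $V_{a,b}(t):=\Sigma_{t+a}+\Sigma_{t+b}-\Sigma_{t+a+b}-\Sigma_t\to0$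 as $\|t\|\to\infty$. 3. If every $\mu_i$ is absolutely continuous with respect to Lebesgue measure, then $B$ is mixing. -/

import Mathlib

open MeasureTheory ProbabilityTheory Filter Topology

/-- The sample path `x ↦ B x ω` of a process `B`. Path spaces `T → F` carry the product
`σ`-algebra. -/
def samplePath {T Ω F : Type*} (B : T → Ω → F) (ω : Ω) : T → F := fun x => B x ω

/-- The increment shift `θ_t` on path space: `(θ_t w)(x) = w (x + t) - w t`. -/
def incrShift {E F : Type*} [Add E] [Sub F] (t : E) (w : E → F) : E → F :=
  fun x => w (x + t) - w t

/-- The shifted event `θ_t A`, as a set of paths. On paths with `w 0 = 0` the inverse of `θ_t` is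
`θ_{-t}`, so `θ_t A` is the preimage of `A` under `θ_{-t}`. -/
def shiftEvent {E F : Type*} [AddGroup E] [Sub F] (t : E) (A : Set (E → F)) : Set (E → F) :=
  {w | incrShift (-t) w ∈ A}

/-- `B` starts at zero and all the processes `θ_t B = (B_{x+t} - B_t)_x` have the law of `B` on
path space. -/
structure HasStationaryIncrements {E F Ω : Type*} [AddGroup E] [AddGroup F] [MeasurableSpace F]
    [MeasurableSpace Ω] (B : E → Ω → F) (P : Measure Ω) : Prop where
  start_zero : ∀ᵐ ω ∂P, B 0 ω = 0
  shift_law : ∀ t : E,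
    P.map (fun ω => incrShift t (samplePath B ω)) = P.map (samplePath B)

/-- Ergodicity for the increment shifts: every event of path space which is invariant under all
`θ_t` (up to null sets of the law of `B`, for each `t`) has probability zero or one.
Invariance modulo null sets is the notion to use for an action of a continuous group on an
uncountable product: an event of the product `σ`-algebra depends on countably many coordinates
only, so that strict invariance under all `θ_t` would leave only trivial events. -/
def IsErgodicProcess {E F Ω : Type*} [AddGroup E] [AddGroup F] [MeasurableSpace F]
    [MeasurableSpace Ω] (B : E → Ω → F) (P : Measure Ω) : Prop :=
  ∀ A : Set (E → F), MeasurableSet A →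
    (∀ t : E, P (symmDiff {ω | samplePath B ω ∈ shiftEvent t A} {ω | samplePath B ω ∈ A}) = 0) →
    P {ω | samplePath B ω ∈ A} = 0 ∨ P {ω | samplePath B ω ∈ A} = 1

/-- Weak mixing for the increment shifts: Cesàro means over the balls of radius `r → ∞` of
`|P(B ∈ θ_t A, B ∈ A') - P(B ∈ A) P(B ∈ A')|` tend to zero. -/
def IsWeaklyMixingProcess {E F Ω : Type*} [NormedAddCommGroup E] [MeasureSpace E]
    [AddGroup F] [MeasurableSpace F] [MeasurableSpace Ω] (B : E → Ω → F) (P : Measure Ω) : Prop :=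
  ∀ A A' : Set (E → F), MeasurableSet A → MeasurableSet A' →
    Tendsto (fun r : ℝ => (volume.real (Metric.ball (0 : E) r))⁻¹ *
      ∫ t in Metric.ball (0 : E) r,
        |P.real {ω | samplePath B ω ∈ shiftEvent t A ∧ samplePath B ω ∈ A'}
          - P.real {ω | samplePath B ω ∈ A} * P.real {ω | samplePath B ω ∈ A'}|)
      atTop (𝓝 0)

/-- (Strong) mixing for the increment shifts:
`P(B ∈ θ_t A, B ∈ A') → P(B ∈ A) P(B ∈ A')` as `‖t‖ → ∞`. -/
def IsMixingProcess {E F Ω : Type*} [NormedAddCommGroup E]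
    [AddGroup F] [MeasurableSpace F] [MeasurableSpace Ω] (B : E → Ω → F) (P : Measure Ω) : Prop :=
  ∀ A A' : Set (E → F), MeasurableSet A → MeasurableSet A' →
    Tendsto (fun t : E => P.real {ω | samplePath B ω ∈ shiftEvent t A ∧ samplePath B ω ∈ A'})
      (comap norm atTop)
      (𝓝 (P.real {ω | samplePath B ω ∈ A} * P.real {ω | samplePath B ω ∈ A'}))

/-- A Lévy measure on `ℝ^d`: a symmetric Borel measure without mass at the origin and with
`∫ (1 ∧ ‖x‖²) dμ < ∞`. -/
structure IsLevyMeasure {d : ℕ} (μ : Measure (EuclideanSpace ℝ (Fin d))) : Prop where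
  symmetric : μ.map (fun x => -x) = μ
  zero_singleton : μ {0} = 0
  lintegral_lt_top : ∫⁻ x, ENNReal.ofReal (min 1 (‖x‖ ^ 2)) ∂μ < ⊤

/-- The real function `v` has the Lévy–Khintchine representation
`v(t) = a ‖t‖² + ∫ |1 - e^{-i(t,x)}|² μ(dx)` with drift `a ≥ 0` and Lévy measure `μ`. -/
structure HasLevyKhintchine {d : ℕ} (v : EuclideanSpace ℝ (Fin d) → ℝ) (a : ℝ)
    (μ : Measure (EuclideanSpace ℝ (Fin d))) : Prop where
  drift_nonneg : 0 ≤ a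
  isLevyMeasure : IsLevyMeasure μ
  eq_integral : ∀ t, v t = a * ‖t‖ ^ 2 +
    ∫ x, ‖1 - Complex.exp (-(Complex.I * ((inner ℝ t x : ℝ) : ℂ)))‖ ^ 2 ∂μ

/-- The matrix-valued variogram `Σ_t`: the covariance matrix of `B_t`. -/
noncomputable def variogram {E Ω : Type*} {d : ℕ} [MeasurableSpace Ω]
    (B : E → Ω → EuclideanSpace ℝ (Fin d)) (P : Measure Ω) (t : E) :
    Matrix (Fin d) (Fin d) ℝ :=
  Matrix.of fun i j => cov[fun ω => B t ω i, fun ω => B t ω j; P]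

/-- `V_{a,b}(t) = Σ_{t+a} + Σ_{t+b} - Σ_{t+a+b} - Σ_t`. -/
noncomputable def variogramDiff {E Ω : Type*} {d : ℕ} [Add E] [MeasurableSpace Ω]
    (B : E → Ω → EuclideanSpace ℝ (Fin d)) (P : Measure Ω) (a b t : E) :
    Matrix (Fin d) (Fin d) ℝ :=
  variogram B P (t + a) + variogram B P (t + b) - variogram B P (t + a + b) - variogram B P t

/-!
Everything takes place on path space under the law `ν` of `B`, where the increment shifts act on
`L²(ν)` by isometries (`IsGaussianPathLaw.koopman`).

*Decorrelation along a filter.* The functions `cos (X + α)`, with `X` a finite linear combination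
of coordinates of the path, are total in `L²(ν)` (`total_cosLp`). For Gaussian `X` and `Y` the
correlation of `cos (X ∘ θ_t + α)` and `cos (Y + β)` is an explicit continuous function of
`Cov (X ∘ θ_t, Y)`, which factorizes when this covariance is zero. Hence, along any filter in `t`,
all pairs of events decorrelate if and only if all pairs of coordinates do
(`IsGaussianPathLaw.tendsto_measureReal_iff`). The covariance of shifted coordinates is half of a
second difference of the variogram, and mixing is the case of the filter of neighbourhoods of
infinity. Strong Cesàro convergence of a bounded function is convergence along the filter
`densityOne` of sets of density one, so that weak mixing is covered by the same equivalence; no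
measurability in `t` of the correlations enters.

*Spectral side.* By the Lévy–Khintchine formula these covariances are cosine transforms of finite
signed measures with a density with respect to `μ_i` (`HasLevyKhintchine.second_difference`).
They vanish at infinity for absolutely continuous `μ_i` by the Riemann–Lebesgue lemma, and along
`densityOne` for non-atomic `μ_i` by Wiener's lemma (`tendsto_average_sq_cosTransform`).

*Ergodicity excludes atoms.* Weak mixing applied twice to an invariant event yields ergodicity. In
an ergodic system the element of minimal norm in the closed convex hull of the orbit of
`f = cos (B_a)_i` is a fixed vector, hence constant. If `μ_i` has an atom, the variance of
`∑ p_k f ∘ θ_{t_k}` is at least a multiple of `∑ p_k p_l R(t_k - t_l)²`, with `R` the covariance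
function of the process `t ↦ (B_{t+a} - B_t)_i`; this is bounded below by a positive multiple of
the squared mass of the atom (`sum_sum_mul_sq_cosTransform_ge`), which is a contradiction.
-/

/-! ### Hilbert space preliminaries -/

/-- A uniformly bounded family of linear functionals which tends to zero on a total set tends to
zero everywhere. -/
lemma tendsto_zero_of_total {H ι : Type*} [NormedAddCommGroup H] [NormedSpace ℝ H]
    {l : Filter ι} {φ : ι → H →L[ℝ] ℝ} {C : ℝ} (hC : ∀ t f, ‖φ t f‖ ≤ C * ‖f‖)
    {S : Set H} (hS : (Submodule.span ℝ S).topologicalClosure = ⊤)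
    (h : ∀ f ∈ S, Tendsto (fun t => φ t f) l (𝓝 0)) (f : H) :
    Tendsto (fun t => φ t f) l (𝓝 0) := by
  have hspan : ∀ g ∈ Submodule.span ℝ S, Tendsto (fun t => φ t g) l (𝓝 0) := by
    intro g hg
    induction hg using Submodule.span_induction with
    | mem x hx => exact h x hx
    | zero => simpa using tendsto_const_nhds
    | add x y _ _ hx hy => simpa using hx.add hy
    | smul c x _ hx => simpa using hx.const_mul c
  have hf : f ∈ closure (Submodule.span ℝ S : Set H) := by
    have : f ∈ (Submodule.span ℝ S).topologicalClosure := by rw [hS]; trivial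
    exact this
  rw [Metric.tendsto_nhds]
  intro ε hε
  have hC' : 0 < |C| + 1 := by positivity
  obtain ⟨g, hg, hfg⟩ := Metric.mem_closure_iff.1 hf (ε / (2 * (|C| + 1))) (by positivity)
  filter_upwards [(Metric.tendsto_nhds.1 (hspan g hg)) (ε / 2) (by positivity)] with t ht
  rw [dist_zero_right] at ht ⊢
  have h1 : ‖φ t (f - g)‖ ≤ ε / 2 := by
    refine (hC t _).trans ?_
    rw [dist_eq_norm] at hfg
    calc C * ‖f - g‖ ≤ (|C| + 1) * ‖f - g‖ := by
          gcongr
          linarith [le_abs_self C]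
      _ ≤ (|C| + 1) * (ε / (2 * (|C| + 1))) := by gcongr
      _ = ε / 2 := by field_simp
  calc ‖φ t f‖ = ‖φ t (f - g) + φ t g‖ := by simp
    _ ≤ ‖φ t (f - g)‖ + ‖φ t g‖ := norm_add_le _ _
    _ < ε := by linarith

/-- Asymptotic decorrelation `⟪U_t f, g⟫ → ⟪f, e⟫ ⟪e, g⟫` for a family of isometries need only be
checked for `f` and `g` in a total set. -/
lemma tendsto_inner_of_total {H ι : Type*} [NormedAddCommGroup H] [InnerProductSpace ℝ H]
    {l : Filter ι} (U : ι → H →ₗᵢ[ℝ] H) (e : H)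
    {S : Set H} (hS : (Submodule.span ℝ S).topologicalClosure = ⊤)
    (h : ∀ f ∈ S, ∀ g ∈ S,
      Tendsto (fun t => inner ℝ (U t f) g) l (𝓝 (inner ℝ f e * inner ℝ e g))) (f g : H) :
    Tendsto (fun t => inner ℝ (U t f) g) l (𝓝 (inner ℝ f e * inner ℝ e g)) := by
  have key : ∀ f ∈ S, ∀ g, Tendsto (fun t => inner ℝ (U t f) g - inner ℝ f e * inner ℝ e g) l
      (𝓝 0) := by
    intro f hf
    refine tendsto_zero_of_total
      (φ := fun t => innerSL ℝ (U t f) - (inner ℝ f e) • innerSL ℝ e)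
      (C := ‖f‖ + |inner ℝ f e| * ‖e‖) (fun t g => ?_) hS (fun g hg => ?_)
    · simp only [_root_.sub_apply, innerSL_apply_apply, _root_.smul_apply,
        smul_eq_mul]
      refine (norm_sub_le _ _).trans ?_
      rw [norm_mul, add_mul, mul_assoc, Real.norm_eq_abs (inner ℝ f e)]
      refine add_le_add ((norm_inner_le_norm _ _).trans (by simp)) ?_
      gcongr
      exact norm_inner_le_norm _ _
    · simpa [← sub_eq_add_neg] using (h f hf g hg).sub_const (inner ℝ f e * inner ℝ e g)
  have key2 : ∀ g f, Tendsto (fun t => inner ℝ (U t f) g - inner ℝ f e * inner ℝ e g) l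
      (𝓝 0) := by
    intro g
    have := tendsto_zero_of_total (l := l)
      (φ := fun t => (innerSL ℝ g).comp (U t).toContinuousLinearMap
        - (inner ℝ e g) • innerSL ℝ e)
      (C := ‖g‖ + |inner ℝ e g| * ‖e‖) (fun t f => ?_) hS (fun f hf => ?_)
    · intro f
      refine (this f).congr fun t => ?_
      simp [real_inner_comm, mul_comm]
    · simp only [_root_.sub_apply, innerSL_apply_apply, _root_.smul_apply,
        smul_eq_mul, ContinuousLinearMap.comp_apply]
      refine (norm_sub_le _ _).trans ?_
      rw [norm_mul, add_mul, mul_assoc, Real.norm_eq_abs (inner ℝ e g)]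
      refine add_le_add ((norm_inner_le_norm _ _).trans (by simp)) ?_
      gcongr
      exact norm_inner_le_norm _ _
    · refine (key f hf g).congr fun t => ?_
      simp [real_inner_comm, mul_comm]
  simpa using (key2 g f).add_const (inner ℝ f e * inner ℝ e g)

/-- The element of minimal norm in the closed convex hull of an orbit is a fixed vector: it is
unique, and the isometries map the hull into itself. -/
lemma exists_fixed_mem_closure_convexHull {H ι : Type*} [NormedAddCommGroup H]
    [InnerProductSpace ℝ H] [CompleteSpace H] [Nonempty ι] [Add ι] (U : ι → H →ₗᵢ[ℝ] H) (f : H)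
    (hU : ∀ s t, U s (U t f) = U (t + s) f) :
    ∃ v ∈ closure (convexHull ℝ (Set.range fun t => U t f)), ∀ s, U s v = v := by
  set K := closure (convexHull ℝ (Set.range fun t => U t f)) with hK
  have hconv : Convex ℝ K := (convex_convexHull ℝ _).closure
  have hne : K.Nonempty :=
    ((Set.range_nonempty _).mono (subset_convexHull ℝ _)).mono subset_closure
  obtain ⟨v, hv, hmin⟩ :=
    exists_norm_eq_iInf_of_complete_convex hne isClosed_closure.isComplete hconv (0 : H)
  rw [norm_eq_iInf_iff_real_inner_le_zero hconv hv] at hmin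
  have hmaps : ∀ s, ∀ w ∈ K, U s w ∈ K := by
    intro s w hw
    have hsub : (U s) '' (convexHull ℝ (Set.range fun t => U t f))
        ⊆ convexHull ℝ (Set.range fun t => U t f) := by
      have := (U s).toLinearMap.image_convexHull (Set.range fun t => U t f)
      simp only [LinearIsometry.coe_toLinearMap] at this
      rw [this]
      refine convexHull_mono ?_
      rintro _ ⟨_, ⟨t, rfl⟩, rfl⟩
      exact ⟨t + s, (hU s t).symm⟩
    exact closure_mono hsub (image_closure_subset_closure_image (U s).continuous ⟨w, hw, rfl⟩)
  refine ⟨v, hv, fun s => ?_⟩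
  have h1 := hmin (U s v) (hmaps s v hv)
  rw [zero_sub, inner_neg_left, inner_sub_right, real_inner_self_eq_norm_sq] at h1
  have h2 : ‖U s v - v‖ ^ 2 = 2 * ‖v‖ ^ 2 - 2 * inner ℝ v (U s v) := by
    rw [norm_sub_sq_real, (U s).norm_map, real_inner_comm]; ring
  have h3 : ‖U s v - v‖ ^ 2 ≤ 0 := by rw [h2]; linarith
  have h4 : ‖U s v - v‖ = 0 := by nlinarith [norm_nonneg (U s v - v)]
  exact sub_eq_zero.1 (norm_eq_zero.1 h4)

/-! ### Linear functionals of a path and their cosines -/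

/-- The finite linear combinations of the coordinates `w ↦ (w x)_i` of a path. -/
def pathFunctionals (E : Type*) (d : ℕ) : Submodule ℝ ((E → EuclideanSpace ℝ (Fin d)) → ℝ) :=
  Submodule.span ℝ (Set.range fun (p : E × Fin d) (w : E → EuclideanSpace ℝ (Fin d)) => w p.1 p.2)

section PathFunctionals

variable {E : Type*} {d : ℕ}

lemma coord_mem_pathFunctionals (x : E) (i : Fin d) :
    (fun w : E → EuclideanSpace ℝ (Fin d) => w x i) ∈ pathFunctionals E d :=
  Submodule.subset_span ⟨(x, i), rfl⟩

lemma exists_clm_of_mem_pathFunctionals {X : (E → EuclideanSpace ℝ (Fin d)) → ℝ}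
    (hX : X ∈ pathFunctionals E d) :
    ∃ (J : Finset E) (L : (J → EuclideanSpace ℝ (Fin d)) →L[ℝ] ℝ), ∀ w, X w = L (J.restrict w) := by
  classical
  obtain ⟨c, rfl⟩ := (Finsupp.mem_span_range_iff_exists_finsupp).1 hX
  refine ⟨c.support.image Prod.fst, ∑ p ∈ c.support.attach, c p.1 •
    ((EuclideanSpace.proj p.1.2 : EuclideanSpace ℝ (Fin d) →L[ℝ] ℝ).comp
      (ContinuousLinearMap.proj (R := ℝ)
        (φ := fun _ : (c.support.image Prod.fst) => EuclideanSpace ℝ (Fin d))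
        ⟨p.1.1, Finset.mem_image_of_mem _ p.2⟩)), fun w => ?_⟩
  rw [Finsupp.sum, ← Finset.sum_attach]
  simp [Finset.restrict]

lemma clm_restrict_mem_pathFunctionals (J : Finset E)
    (L : (J → EuclideanSpace ℝ (Fin d)) →L[ℝ] ℝ) :
    (fun w : E → EuclideanSpace ℝ (Fin d) => L (J.restrict w)) ∈ pathFunctionals E d := by
  classical
  have h : (fun w : E → EuclideanSpace ℝ (Fin d) => L (J.restrict w)) =
      ∑ x : J, ∑ i : Fin d, (L (Pi.single x (EuclideanSpace.single i 1))) •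
        (fun w : E → EuclideanSpace ℝ (Fin d) => w x i) := by
    ext w
    have h1 : J.restrict w = ∑ x : J, ∑ i : Fin d,
        (w x i) • (Pi.single x (EuclideanSpace.single i (1 : ℝ)) :
          J → EuclideanSpace ℝ (Fin d)) := by
      ext y j
      simp [Finset.sum_apply, Pi.single_apply, Finset.restrict, apply_ite]
    rw [h1]
    simp [mul_comm]
  rw [h]
  exact Submodule.sum_mem _ fun x _ => Submodule.sum_mem _ fun i _ =>
    Submodule.smul_mem _ _ (coord_mem_pathFunctionals _ _)

lemma measurable_of_mem_pathFunctionals {X : (E → EuclideanSpace ℝ (Fin d)) → ℝ}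
    (hX : X ∈ pathFunctionals E d) : Measurable X := by
  obtain ⟨J, L, hL⟩ := exists_clm_of_mem_pathFunctionals hX
  rw [funext hL]
  exact L.continuous.measurable.comp (Finset.measurable_restrict J)

lemma comp_incrShift_mem_pathFunctionals [Add E] (t : E)
    {X : (E → EuclideanSpace ℝ (Fin d)) → ℝ} (hX : X ∈ pathFunctionals E d) :
    (fun w => X (incrShift t w)) ∈ pathFunctionals E d := by
  induction hX using Submodule.span_induction with
  | mem x hx =>
    obtain ⟨p, rfl⟩ := hx
    exact Submodule.sub_mem _ (coord_mem_pathFunctionals (p.1 + t) p.2)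
      (coord_mem_pathFunctionals t p.2)
  | zero => exact Submodule.zero_mem _
  | add x y _ _ hx hy => exact Submodule.add_mem _ hx hy
  | smul c x _ hx => exact Submodule.smul_mem _ c hx

lemma measurable_incrShift {F : Type*} [Add E] [MeasurableSpace F] [Sub F] [MeasurableSub₂ F]
    (t : E) : Measurable (incrShift t : (E → F) → (E → F)) :=
  measurable_pi_lambda _ fun x => (measurable_pi_apply (x + t)).sub (measurable_pi_apply t)

lemma incrShift_incrShift {F : Type*} [AddCommGroup E] [AddCommGroup F] (s t : E) (w : E → F) :
    incrShift t (incrShift s w) = incrShift (t + s) w := by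
  ext x
  simp only [incrShift, ← add_assoc]
  abel

/-- The function `w ↦ cos (X w + α)` as an element of `L²`. -/
noncomputable def cosLp {W : Type*} [MeasurableSpace W] (ν : Measure W) [IsFiniteMeasure ν]
    {X : W → ℝ} (hX : Measurable X) (α : ℝ) : Lp ℝ 2 ν :=
  MemLp.toLp (fun w => Real.cos (X w + α))
    (MemLp.of_bound (by fun_prop) 1 (Eventually.of_forall fun w => by
      simpa using Real.abs_cos_le_one _))

lemma coeFn_cosLp {W : Type*} [MeasurableSpace W] (ν : Measure W) [IsFiniteMeasure ν]
    {X : W → ℝ} (hX : Measurable X) (α : ℝ) :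
    cosLp ν hX α =ᵐ[ν] fun w => Real.cos (X w + α) :=
  MemLp.coeFn_toLp _

/-- The trigonometric functions of linear functionals of the path are total in `L²`: a function
orthogonal to all of them is the density of a signed measure all of whose finite-dimensional
marginals have zero characteristic function. -/
lemma total_cosLp (ν : Measure (E → EuclideanSpace ℝ (Fin d))) [IsFiniteMeasure ν] :
    (Submodule.span ℝ {f : Lp ℝ 2 ν | ∃ (X : _) (hX : X ∈ pathFunctionals E d) (α : ℝ),
      f = cosLp ν (measurable_of_mem_pathFunctionals hX) α}).topologicalClosure = ⊤ := by
  rw [Submodule.topologicalClosure_eq_top_iff, Submodule.eq_bot_iff]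
  intro g hg
  rw [Submodule.mem_orthogonal] at hg
  have hgi : Integrable g ν := (Lp.memLp g).integrable (by norm_num)
  have hcos : ∀ X ∈ pathFunctionals E d, ∀ α : ℝ, ∫ w, g w * Real.cos (X w + α) ∂ν = 0 := by
    intro X hX α
    have h := hg _ (Submodule.subset_span ⟨X, hX, α, rfl⟩)
    rw [L2.inner_def] at h
    rw [← h]
    refine integral_congr_ae ?_
    filter_upwards [coeFn_cosLp ν (measurable_of_mem_pathFunctionals hX) α] with w hw
    rw [hw]
    simp
  have hgm : Measurable g := (Lp.stronglyMeasurable g).measurable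
  have hexp : ∀ X ∈ pathFunctionals E d,
      ∫ w, ((g w : ℝ) : ℂ) * Complex.exp (X w * Complex.I) ∂ν = 0 := by
    intro X hX
    have hXm := measurable_of_mem_pathFunctionals hX
    have h1 := hcos X hX 0
    have h2 := hcos X hX (-(Real.pi / 2))
    simp only [← sub_eq_add_neg, Real.cos_sub_pi_div_two, add_zero] at h1 h2
    have hi : ∀ φ : ℝ → ℝ, Measurable φ → (∀ x, |φ x| ≤ 1) →
        Integrable (fun w => g w * φ (X w)) ν := fun φ hφ hb =>
      hgi.mul_bdd (c := 1) (hφ.comp hXm).aestronglyMeasurable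
        (Eventually.of_forall fun w => by simpa using hb (X w))
    have heq : (fun w => ((g w : ℝ) : ℂ) * Complex.exp (X w * Complex.I)) = fun w =>
        ((g w * Real.cos (X w) : ℝ) : ℂ) + ((g w * Real.sin (X w) : ℝ) : ℂ) * Complex.I := by
      ext w
      rw [Complex.exp_mul_I]
      push_cast
      ring
    rw [heq, integral_add, integral_mul_const, integral_complex_ofReal, integral_complex_ofReal,
      h1, h2]
    · simp
    · exact (hi _ Real.measurable_cos Real.abs_cos_le_one).ofReal
    · exact (hi _ Real.measurable_sin Real.abs_sin_le_one).ofReal.mul_const _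
  have hfin : ∀ h : (E → EuclideanSpace ℝ (Fin d)) → ℝ, Integrable h ν →
      ∫⁻ w, ENNReal.ofReal (h w) ∂ν ≠ ⊤ := fun h hh =>
    ((lintegral_ofReal_le_lintegral_enorm _).trans_lt hh.2).ne
  set μ₁ := ν.withDensity fun w => ENNReal.ofReal (g w) with hμ₁
  set μ₂ := ν.withDensity fun w => ENNReal.ofReal (-g w) with hμ₂
  have : IsFiniteMeasure μ₁ := isFiniteMeasure_withDensity (hfin _ hgi)
  have : IsFiniteMeasure μ₂ := isFiniteMeasure_withDensity (hfin _ hgi.neg)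
  have hmarg : ∀ J : Finset E, μ₂.map J.restrict = μ₁.map J.restrict := by
    intro J
    refine (Measure.ext_of_charFunDual ?_).symm
    ext L
    have hX := clm_restrict_mem_pathFunctionals J L
    have hXm := measurable_of_mem_pathFunctionals hX
    have hE : Continuous fun v : J → EuclideanSpace ℝ (Fin d) =>
        Complex.exp (L v * Complex.I) := by fun_prop
    have hEi : ∀ h : (E → EuclideanSpace ℝ (Fin d)) → ℝ, Integrable h ν →
        Integrable (fun w => (h w : ℝ) • Complex.exp (L (J.restrict w) * Complex.I)) ν := by
      intro h hh
      refine Integrable.smul_bdd (C := 1) hh ?_ ?_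
      · exact (hE.measurable.comp (Finset.measurable_restrict J)).aestronglyMeasurable
      · exact Eventually.of_forall fun w => by rw [Complex.norm_exp_ofReal_mul_I]
    rw [charFunDual_apply, charFunDual_apply,
      integral_map (Finset.measurable_restrict J).aemeasurable hE.aestronglyMeasurable,
      integral_map (Finset.measurable_restrict J).aemeasurable hE.aestronglyMeasurable,
      hμ₁, hμ₂, integral_withDensity_eq_integral_toReal_smul (by fun_prop) (by simp),
      integral_withDensity_eq_integral_toReal_smul (by fun_prop) (by simp), ← sub_eq_zero,
      ← integral_sub, ← hexp _ hX]
    · refine integral_congr_ae (Eventually.of_forall fun w => ?_)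
      simp only [ENNReal.toReal_ofReal', ← sub_smul, max_zero_sub_eq_self]
      simp
    · simpa only [ENNReal.toReal_ofReal'] using hEi _ hgi.pos_part
    · simpa only [ENNReal.toReal_ofReal'] using hEi _ hgi.neg_part
  have heq : μ₁ = μ₂ :=
    IsProjectiveLimit.unique (P := fun J => μ₁.map J.restrict) (fun J => rfl) (fun J => hmarg J)
  have hae := (withDensity_eq_iff (by fun_prop) (by fun_prop) (hfin _ hgi)).1 heq
  rw [Lp.eq_zero_iff_ae_eq_zero]
  filter_upwards [hae] with w hw
  have h2 := congrArg ENNReal.toReal hw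
  simp only [ENNReal.toReal_ofReal'] at h2
  have h3 := max_zero_sub_eq_self (g w)
  rw [Pi.zero_apply, ← h3, h2, sub_self]

end PathFunctionals

/-! ### Gaussian path laws and covariances of shifted functionals -/

/-- The law on path space of a centered Gaussian process with stationary increments. -/
structure IsGaussianPathLaw {E : Type*} {d : ℕ} [Add E]
    (ν : Measure (E → EuclideanSpace ℝ (Fin d))) : Prop where
  gaussian : ∀ X ∈ pathFunctionals E d, HasGaussianLaw X ν
  centered : ∀ X ∈ pathFunctionals E d, ∫ w, X w ∂ν = 0
  shift : ∀ t : E, MeasurePreserving (incrShift t) ν ν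

lemma integral_cos_add_of_hasGaussianLaw {Ω : Type*} [MeasurableSpace Ω] {P : Measure Ω}
    {X : Ω → ℝ} (hX : HasGaussianLaw X P) (h0 : ∫ ω, X ω ∂P = 0) (α : ℝ) :
    ∫ ω, Real.cos (X ω + α) ∂P = Real.exp (-(∫ ω, X ω ^ 2 ∂P) / 2) * Real.cos α := by
  have := hX.isProbabilityMeasure
  have hXm : AEMeasurable X P := hX.aemeasurable
  have hvar : Var[X; P] = ∫ ω, X ω ^ 2 ∂P := by
    rw [variance_eq_integral hXm]
    simp [h0]
  have hv0 : 0 ≤ ∫ ω, X ω ^ 2 ∂P := integral_nonneg fun ω => sq_nonneg _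
  have hmap := hX.map_eq_gaussianReal
  rw [h0, hvar] at hmap
  have hchar : ∫ ω, Complex.exp (X ω * Complex.I) ∂P
      = ((Real.exp (-(∫ ω, X ω ^ 2 ∂P) / 2) : ℝ) : ℂ) := by
    have h1 := charFun_gaussianReal (μ := 0) (v := (∫ ω, X ω ^ 2 ∂P).toNNReal) 1
    rw [← hmap, charFun_apply, integral_map hXm
      (Continuous.aestronglyMeasurable (by fun_prop))] at h1
    simp only [RCLike.inner_apply, conj_trivial, one_mul] at h1
    rw [h1, Real.coe_toNNReal _ hv0]
    push_cast
    congr 1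
    ring
  have hint :
      Integrable (fun ω => Complex.exp (X ω * Complex.I) * Complex.exp (α * Complex.I)) P := by
    refine Integrable.mul_const ?_ _
    refine Integrable.of_bound (C := 1) ?_ (Eventually.of_forall fun ω => ?_)
    · exact (Continuous.aestronglyMeasurable
        (f := fun x : ℝ => Complex.exp (x * Complex.I)) (by fun_prop)).comp_aemeasurable hXm
    · rw [Complex.norm_exp_ofReal_mul_I]
  calc ∫ ω, Real.cos (X ω + α) ∂P
      = ∫ ω, (Complex.exp (X ω * Complex.I) * Complex.exp (α * Complex.I)).re ∂P := by
        refine integral_congr_ae (Eventually.of_forall fun ω => ?_)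
        simp only
        rw [← Complex.exp_add, ← add_mul, ← Complex.ofReal_add, Complex.exp_ofReal_mul_I_re]
    _ = (∫ ω, Complex.exp (X ω * Complex.I) * Complex.exp (α * Complex.I) ∂P).re :=
        integral_re hint
    _ = _ := by
        rw [integral_mul_const, hchar, Complex.re_ofReal_mul, Complex.exp_ofReal_mul_I_re]

section GaussianPathLaw

variable {E : Type*} {d : ℕ} [Add E] {ν : Measure (E → EuclideanSpace ℝ (Fin d))}

namespace IsGaussianPathLaw

lemma isProbabilityMeasure (h : IsGaussianPathLaw ν) : IsProbabilityMeasure ν :=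
  (h.gaussian 0 (Submodule.zero_mem _)).isProbabilityMeasure

lemma memLp_two (h : IsGaussianPathLaw ν) {X : (E → EuclideanSpace ℝ (Fin d)) → ℝ}
    (hX : X ∈ pathFunctionals E d) : MemLp X 2 ν :=
  (h.gaussian X hX).memLp (by norm_num)

lemma integrable_mul (h : IsGaussianPathLaw ν) {X Y : (E → EuclideanSpace ℝ (Fin d)) → ℝ}
    (hX : X ∈ pathFunctionals E d) (hY : Y ∈ pathFunctionals E d) :
    Integrable (fun w => X w * Y w) ν :=
  (h.memLp_two hX).integrable_mul (h.memLp_two hY)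

lemma integral_sq_add (h : IsGaussianPathLaw ν) {X Y : (E → EuclideanSpace ℝ (Fin d)) → ℝ}
    (hX : X ∈ pathFunctionals E d) (hY : Y ∈ pathFunctionals E d) :
    ∫ w, (X w + Y w) ^ 2 ∂ν
      = ∫ w, X w ^ 2 ∂ν + ∫ w, Y w ^ 2 ∂ν + 2 * ∫ w, X w * Y w ∂ν := by
  have h1 := (h.memLp_two hX).integrable_sq
  have h2 := (h.memLp_two hY).integrable_sq
  have h3 := h.integrable_mul hX hY
  rw [← integral_const_mul, ← integral_add h1 h2, 
    ← integral_add (f := fun w => X w ^ 2 + Y w ^ 2) (h1.add h2) (h3.const_mul 2)]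
  exact integral_congr_ae (Eventually.of_forall fun w => by ring)

lemma integral_sq_sub (h : IsGaussianPathLaw ν) {X Y : (E → EuclideanSpace ℝ (Fin d)) → ℝ}
    (hX : X ∈ pathFunctionals E d) (hY : Y ∈ pathFunctionals E d) :
    ∫ w, (X w - Y w) ^ 2 ∂ν
      = ∫ w, X w ^ 2 ∂ν + ∫ w, Y w ^ 2 ∂ν - 2 * ∫ w, X w * Y w ∂ν := by
  have h1 := h.integral_sq_add hX (Submodule.neg_mem _ hY)
  simp only [Pi.neg_apply, mul_neg, integral_neg, neg_sq] at h1
  simpa [sub_eq_add_neg] using h1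

/-- Correlations of the trigonometric observables of a Gaussian law in terms of the covariance of
the underlying linear functionals. -/
lemma integral_cos_mul_cos (h : IsGaussianPathLaw ν)
    {X Y : (E → EuclideanSpace ℝ (Fin d)) → ℝ}
    (hX : X ∈ pathFunctionals E d) (hY : Y ∈ pathFunctionals E d) (α β : ℝ) :
    ∫ w, Real.cos (X w + α) * Real.cos (Y w + β) ∂ν
      = Real.exp (-(∫ w, X w ^ 2 ∂ν) / 2) * Real.exp (-(∫ w, Y w ^ 2 ∂ν) / 2) *
        ((Real.exp (-∫ w, X w * Y w ∂ν) * Real.cos (α + β)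
          + Real.exp (∫ w, X w * Y w ∂ν) * Real.cos (α - β)) / 2) := by
  have := h.isProbabilityMeasure
  have hadd := Submodule.add_mem _ hX hY
  have hsub := Submodule.sub_mem _ hX hY
  have h1 := integral_cos_add_of_hasGaussianLaw (h.gaussian _ hadd) (h.centered _ hadd) (α + β)
  have h2 := integral_cos_add_of_hasGaussianLaw (h.gaussian _ hsub) (h.centered _ hsub) (α - β)
  simp only [Pi.add_apply] at h1
  simp only [Pi.sub_apply] at h2
  rw [h.integral_sq_add hX hY] at h1
  rw [h.integral_sq_sub hX hY] at h2
  have hXm := measurable_of_mem_pathFunctionals hX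
  have hYm := measurable_of_mem_pathFunctionals hY
  have hb : ∀ f : (E → EuclideanSpace ℝ (Fin d)) → ℝ, Measurable f →
      Integrable (fun w => Real.cos (f w)) ν := fun f hf =>
    Integrable.of_bound (C := 1) (Real.measurable_cos.comp hf).aestronglyMeasurable
      (Eventually.of_forall fun w => by simpa using Real.abs_cos_le_one _)
  have heq : (fun w => Real.cos (X w + α) * Real.cos (Y w + β)) = fun w =>
      (Real.cos (X w + Y w + (α + β)) + Real.cos (X w - Y w + (α - β))) / 2 := by
    ext w
    rw [show X w + Y w + (α + β) = (X w + α) + (Y w + β) by ring,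
      show X w - Y w + (α - β) = (X w + α) - (Y w + β) by ring, Real.cos_add (X w + α),
      Real.cos_sub (X w + α)]
    ring
  rw [heq, integral_div, integral_add (hb _ (by fun_prop)) (hb _ (by fun_prop)), h1, h2,
    ← Real.exp_add]
  rw [mul_div_assoc', mul_add, ← mul_assoc, ← mul_assoc, ← Real.exp_add, ← Real.exp_add]
  ring_nf

/-- The Koopman operator of the increment shift on `L²` of the path law. -/
noncomputable def koopman (h : IsGaussianPathLaw ν) (t : E) : Lp ℝ 2 ν →ₗᵢ[ℝ] Lp ℝ 2 ν :=
  Lp.compMeasurePreservingₗᵢ ℝ (incrShift t) (h.shift t)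

lemma coeFn_koopman (h : IsGaussianPathLaw ν) (t : E) (f : Lp ℝ 2 ν) :
    h.koopman t f =ᵐ[ν] fun w => f (incrShift t w) :=
  Lp.coeFn_compMeasurePreserving f (h.shift t)

lemma inner_koopman_eq (h : IsGaussianPathLaw ν) (t : E) {f g : Lp ℝ 2 ν}
    {f' g' : (E → EuclideanSpace ℝ (Fin d)) → ℝ} (hf : f =ᵐ[ν] f') (hg : g =ᵐ[ν] g') :
    inner ℝ (h.koopman t f) g = ∫ w, f' (incrShift t w) * g' w ∂ν := by
  rw [L2.inner_def]
  refine integral_congr_ae ?_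
  filter_upwards [h.coeFn_koopman t f, (h.shift t).quasiMeasurePreserving.ae_eq_comp hf, hg]
    with w h1 h2 h3
  simp only [Function.comp_apply] at h2
  rw [h1, h2, h3]
  simp [mul_comm]

lemma integral_comp_incrShift (h : IsGaussianPathLaw ν) (t : E)
    {f : (E → EuclideanSpace ℝ (Fin d)) → ℝ} (hf : Measurable f) :
    ∫ w, f (incrShift t w) ∂ν = ∫ w, f w ∂ν := by
  conv_rhs => rw [← (h.shift t).map_eq]
  rw [integral_map (h.shift t).measurable.aemeasurable hf.aestronglyMeasurable]

end IsGaussianPathLaw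

end GaussianPathLaw

/-! ### Decorrelation of events and of coordinates -/

section Decorrelation

variable {E : Type*} {d : ℕ} [Add E] {ν : Measure (E → EuclideanSpace ℝ (Fin d))}

lemma inner_const_one_right {W : Type*} [MeasurableSpace W] {ν : Measure W} [IsFiniteMeasure ν]
    {f : Lp ℝ 2 ν} {f' : W → ℝ} (hf : f =ᵐ[ν] f') :
    inner ℝ f (Lp.const 2 ν (1 : ℝ)) = ∫ w, f' w ∂ν := by
  rw [L2.inner_def]
  refine integral_congr_ae ?_
  filter_upwards [hf, Lp.coeFn_const 2 ν (1 : ℝ)] with w h1 h2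
  rw [h1, h2]
  simp

lemma inner_const_one_left {W : Type*} [MeasurableSpace W] {ν : Measure W} [IsFiniteMeasure ν]
    {f : Lp ℝ 2 ν} {f' : W → ℝ} (hf : f =ᵐ[ν] f') :
    inner ℝ (Lp.const 2 ν (1 : ℝ)) f = ∫ w, f' w ∂ν := by
  rw [real_inner_comm, inner_const_one_right hf]

/-- Indicators of events are total in `L²`. -/
lemma total_indicatorConstLp {W : Type*} [MeasurableSpace W] (ν : Measure W) [IsFiniteMeasure ν] :
    (Submodule.span ℝ {f : Lp ℝ 2 ν | ∃ (A : Set W) (hA : MeasurableSet A),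
      f = indicatorConstLp 2 hA (measure_ne_top ν A) 1}).topologicalClosure = ⊤ := by
  rw [eq_top_iff]
  rintro f -
  refine Lp.induction (by norm_num)
    (motive := fun f => f ∈ (Submodule.span ℝ {f : Lp ℝ 2 ν | ∃ (A : Set W) (hA : MeasurableSet A),
      f = indicatorConstLp 2 hA (measure_ne_top ν A) 1}).topologicalClosure) ?_ ?_ ?_ f
  · intro c A hA hνA
    have h1 : (Lp.simpleFunc.indicatorConst 2 hA hνA.ne c : Lp ℝ 2 ν)
        = c • indicatorConstLp 2 hA (measure_ne_top ν A) (1 : ℝ) := by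
      rw [Lp.simpleFunc.coe_indicatorConst]
      refine Lp.ext ?_
      filter_upwards [indicatorConstLp_coeFn (p := 2) (hs := hA) (hμs := hνA.ne) (c := c),
        indicatorConstLp_coeFn (p := 2) (hs := hA) (hμs := hνA.ne) (c := (1 : ℝ)),
        Lp.coeFn_smul c (indicatorConstLp 2 hA hνA.ne (1 : ℝ))] with w h1 h2 h3
      rw [h1, h3, Pi.smul_apply, h2]
      by_cases hw : w ∈ A <;> simp [hw]
    rw [h1]
    exact Submodule.smul_mem _ _ (Submodule.le_topologicalClosure _
      (Submodule.subset_span ⟨A, hA, rfl⟩))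
  · intro f g hf hg _ h1 h2
    exact Submodule.add_mem _ h1 h2
  · exact Submodule.isClosed_topologicalClosure _

namespace IsGaussianPathLaw

lemma tendsto_integral_shift_mul (h : IsGaussianPathLaw ν) {l : Filter E}
    (hcov : ∀ x y i j, Tendsto (fun t => ∫ w, (w (x + t) i - w t i) * w y j ∂ν) l (𝓝 0))
    {X Y : (E → EuclideanSpace ℝ (Fin d)) → ℝ}
    (hX : X ∈ pathFunctionals E d) (hY : Y ∈ pathFunctionals E d) :
    Tendsto (fun t => ∫ w, X (incrShift t w) * Y w ∂ν) l (𝓝 0) := by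
  induction hX using Submodule.span_induction with
  | mem X hX =>
    obtain ⟨p, rfl⟩ := hX
    have hp : ∀ t, (fun w : E → EuclideanSpace ℝ (Fin d) => incrShift t w p.1 p.2)
        ∈ pathFunctionals E d := fun t =>
      comp_incrShift_mem_pathFunctionals t (coord_mem_pathFunctionals p.1 p.2)
    induction hY using Submodule.span_induction with
    | mem Y hY =>
      obtain ⟨q, rfl⟩ := hY
      exact hcov p.1 q.1 p.2 q.2
    | zero => simpa using tendsto_const_nhds
    | add Y Z hY hZ h1 h2 =>
      have := h1.add h2
      rw [add_zero] at this
      refine this.congr fun t => ?_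
      rw [← integral_add (h.integrable_mul (hp t) hY) (h.integrable_mul (hp t) hZ)]
      simp only [Pi.add_apply, mul_add]
    | smul c Y _ h1 =>
      have := h1.const_mul c
      rw [mul_zero] at this
      refine this.congr fun t => ?_
      rw [← integral_const_mul]
      simp only [Pi.smul_apply, smul_eq_mul, mul_left_comm]
  | zero => simpa using tendsto_const_nhds
  | add X Z hX hZ h1 h2 =>
    have := h1.add h2
    rw [add_zero] at this
    refine this.congr fun t => ?_
    rw [← integral_add (h.integrable_mul (comp_incrShift_mem_pathFunctionals t hX) hY)
      (h.integrable_mul (comp_incrShift_mem_pathFunctionals t hZ) hY)]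
    simp only [Pi.add_apply, add_mul]
  | smul c X _ h1 =>
    have := h1.const_mul c
    rw [mul_zero] at this
    refine this.congr fun t => ?_
    rw [← integral_const_mul]
    simp only [Pi.smul_apply, smul_eq_mul, mul_assoc]

lemma inner_koopman_cosLp (h : IsGaussianPathLaw ν) [IsFiniteMeasure ν] (t : E)
    {X Y : (E → EuclideanSpace ℝ (Fin d)) → ℝ}
    (hX : X ∈ pathFunctionals E d) (hY : Y ∈ pathFunctionals E d) (α β : ℝ) :
    inner ℝ (h.koopman t (cosLp ν (measurable_of_mem_pathFunctionals hX) α))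
        (cosLp ν (measurable_of_mem_pathFunctionals hY) β)
      = Real.exp (-(∫ w, X w ^ 2 ∂ν) / 2) * Real.exp (-(∫ w, Y w ^ 2 ∂ν) / 2) *
        ((Real.exp (-∫ w, X (incrShift t w) * Y w ∂ν) * Real.cos (α + β)
          + Real.exp (∫ w, X (incrShift t w) * Y w ∂ν) * Real.cos (α - β)) / 2) := by
  rw [h.inner_koopman_eq t (coeFn_cosLp ν _ α) (coeFn_cosLp ν _ β),
    h.integral_cos_mul_cos (comp_incrShift_mem_pathFunctionals t hX) hY α β,
    h.integral_comp_incrShift t (f := fun w => X w ^ 2)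
      ((measurable_of_mem_pathFunctionals hX).pow_const 2)]

/-- Along any filter, all square-integrable observables decorrelate under the increment shifts as
soon as the coordinates do: the trigonometric observables decorrelate by an explicit Gaussian computation, and
they are total in `L²`. -/
lemma tendsto_inner_koopman (h : IsGaussianPathLaw ν) [IsFiniteMeasure ν] {l : Filter E}
    (hcov : ∀ x y i j, Tendsto (fun t => ∫ w, (w (x + t) i - w t i) * w y j ∂ν) l (𝓝 0))
    (f g : Lp ℝ 2 ν) :
    Tendsto (fun t => inner ℝ (h.koopman t f) g) l
      (𝓝 (inner ℝ f (Lp.const 2 ν (1 : ℝ)) * inner ℝ (Lp.const 2 ν (1 : ℝ)) g)) := by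
  refine tendsto_inner_of_total h.koopman _ (total_cosLp ν) ?_ f g
  rintro _ ⟨X, hX, α, rfl⟩ _ ⟨Y, hY, β, rfl⟩
  rw [inner_const_one_right (coeFn_cosLp ν _ α), inner_const_one_left (coeFn_cosLp ν _ β),
    integral_cos_add_of_hasGaussianLaw (h.gaussian X hX) (h.centered X hX),
    integral_cos_add_of_hasGaussianLaw (h.gaussian Y hY) (h.centered Y hY)]
  simp only [h.inner_koopman_cosLp _ hX hY]
  have hR := h.tendsto_integral_shift_mul hcov hX hY
  have hlim : Real.exp (-(∫ w, X w ^ 2 ∂ν) / 2) * Real.cos α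
      * (Real.exp (-(∫ w, Y w ^ 2 ∂ν) / 2) * Real.cos β)
      = Real.exp (-(∫ w, X w ^ 2 ∂ν) / 2) * Real.exp (-(∫ w, Y w ^ 2 ∂ν) / 2) *
        ((Real.exp (-0) * Real.cos (α + β) + Real.exp 0 * Real.cos (α - β)) / 2) := by
    rw [neg_zero, Real.exp_zero, Real.cos_add, Real.cos_sub]
    ring
  rw [hlim]
  refine Tendsto.const_mul _ (Tendsto.div_const (Tendsto.add ?_ ?_) 2)
  · exact (Real.continuous_exp.continuousAt.tendsto.comp hR.neg).mul_const _
  · exact (Real.continuous_exp.continuousAt.tendsto.comp hR).mul_const _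

lemma inner_koopman_indicator (h : IsGaussianPathLaw ν) [IsFiniteMeasure ν] (t : E)
    {A A' : Set (E → EuclideanSpace ℝ (Fin d))} (hA : MeasurableSet A) (hA' : MeasurableSet A') :
    inner ℝ (h.koopman t (indicatorConstLp 2 hA (measure_ne_top ν A) 1))
        (indicatorConstLp 2 hA' (measure_ne_top ν A') 1)
      = ν.real (incrShift t ⁻¹' A ∩ A') := by
  rw [h.inner_koopman_eq t indicatorConstLp_coeFn indicatorConstLp_coeFn,
    ← integral_indicator_one (((h.shift t).measurable hA).inter hA')]
  refine integral_congr_ae (Eventually.of_forall fun w => ?_)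
  by_cases h1 : incrShift t w ∈ A <;> by_cases h2 : w ∈ A' <;> simp [h1, h2, Set.indicator]

/-- Along any filter, decorrelation of all pairs of events under the increment shifts is
equivalent to decorrelation of the coordinates. -/
theorem tendsto_measureReal_iff (h : IsGaussianPathLaw ν) {l : Filter E} :
    (∀ A A' : Set (E → EuclideanSpace ℝ (Fin d)), MeasurableSet A → MeasurableSet A' →
      Tendsto (fun t => ν.real (incrShift t ⁻¹' A ∩ A')) l (𝓝 (ν.real A * ν.real A'))) ↔
    ∀ x y i j, Tendsto (fun t => ∫ w, (w (x + t) i - w t i) * w y j ∂ν) l (𝓝 0) := by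
  have := h.isProbabilityMeasure
  have hind : ∀ A : Set (E → EuclideanSpace ℝ (Fin d)), MeasurableSet A →
      ∫ w, A.indicator (fun _ => (1 : ℝ)) w ∂ν = ν.real A := fun A hA =>
    integral_indicator_one hA
  constructor
  · intro hev x y i j
    have hx := coord_mem_pathFunctionals x i (E := E)
    have hy := coord_mem_pathFunctionals y j (E := E)
    have hlim := tendsto_inner_of_total (l := l) h.koopman (Lp.const 2 ν (1 : ℝ))
      (total_indicatorConstLp ν) ?_ (h.memLp_two hx).toLp (h.memLp_two hy).toLp
    · rw [inner_const_one_right (h.memLp_two hx).coeFn_toLp, h.centered _ hx, zero_mul] at hlim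
      refine hlim.congr fun t => ?_
      rw [h.inner_koopman_eq t (h.memLp_two hx).coeFn_toLp (h.memLp_two hy).coeFn_toLp]
      rfl
    · rintro _ ⟨A, hA, rfl⟩ _ ⟨A', hA', rfl⟩
      rw [inner_const_one_right indicatorConstLp_coeFn, inner_const_one_left indicatorConstLp_coeFn,
        hind A hA, hind A' hA']
      simpa only [h.inner_koopman_indicator] using hev A A' hA hA'
  · intro hcov A A' hA hA'
    have hlim := h.tendsto_inner_koopman hcov (indicatorConstLp 2 hA (measure_ne_top ν A) 1)
      (indicatorConstLp 2 hA' (measure_ne_top ν A') 1)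
    rw [inner_const_one_right indicatorConstLp_coeFn, inner_const_one_left indicatorConstLp_coeFn,
        hind A hA, hind A' hA'] at hlim
    simpa only [h.inner_koopman_indicator] using hlim

end IsGaussianPathLaw

end Decorrelation

/-! ### Density-one convergence -/

section Density

variable {V : Type*} [NormedAddCommGroup V] [MeasureSpace V]
  [IsFiniteMeasureOnCompacts (volume : Measure V)] [ProperSpace V]

/-- The filter of subsets of asymptotic density one with respect to balls about the origin. For
bounded functions, convergence along it amounts to strong Cesàro convergence. No measurability is
required: `volume.real` is used as an outer measure. -/
noncomputable def densityOne (V : Type*) [NormedAddCommGroup V] [MeasureSpace V]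
    [IsFiniteMeasureOnCompacts (volume : Measure V)] [ProperSpace V] : Filter V where
  sets := {S | Tendsto (fun r : ℝ => (volume.real (Metric.ball (0 : V) r))⁻¹ *
    volume.real (Metric.ball (0 : V) r \ S)) atTop (𝓝 0)}
  univ_sets := by simp
  sets_of_superset {S T} hS hST := by
    refine squeeze_zero (fun r => by positivity) (fun r => ?_) hS
    gcongr
    exact measure_ne_top_of_subset Set.sdiff_subset measure_ball_lt_top.ne
  inter_sets {S T} hS hT := by
    have h := Tendsto.add hS hT
    rw [add_zero] at h
    refine squeeze_zero (fun r => by positivity) (fun r => ?_) h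
    rw [← mul_add, Set.sdiff_inter]
    gcongr
    exact measureReal_union_le _ _

lemma mem_densityOne {S : Set V} : S ∈ densityOne V ↔
    Tendsto (fun r : ℝ => (volume.real (Metric.ball (0 : V) r))⁻¹ *
      volume.real (Metric.ball (0 : V) r \ S)) atTop (𝓝 0) := Iff.rfl

lemma volume_real_ball_pos [(volume : Measure V).IsOpenPosMeasure] {r : ℝ} (hr : 0 < r) :
    0 < volume.real (Metric.ball (0 : V) r) :=
  ENNReal.toReal_pos (Metric.measure_ball_pos _ _ hr).ne' measure_ball_lt_top.ne

variable [OpensMeasurableSpace V]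

/-- Chebyshev's inequality turns vanishing quadratic means into density-one convergence. -/
lemma tendsto_densityOne_of_sq {φ : V → ℝ}
    (hφ : ∀ r, IntegrableOn (fun t => φ t ^ 2) (Metric.ball (0 : V) r))
    (h : Tendsto (fun r : ℝ => (volume.real (Metric.ball (0 : V) r))⁻¹ *
      ∫ t in Metric.ball (0 : V) r, φ t ^ 2) atTop (𝓝 0)) :
    Tendsto φ (densityOne V) (𝓝 0) := by
  rw [Metric.tendsto_nhds]
  intro ε hε
  have h' := h.const_mul ((ε ^ 2)⁻¹)
  rw [mul_zero] at h'
  refine mem_densityOne.2 (squeeze_zero (fun r => by positivity) (fun r => ?_) h')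
  have hM := mul_meas_ge_le_integral_of_nonneg (μ := volume.restrict (Metric.ball (0 : V) r))
    (Eventually.of_forall fun t => sq_nonneg (φ t)) (hφ r) (ε ^ 2)
  rw [mul_left_comm]
  gcongr
  rw [le_inv_mul_iff₀ (by positivity)]
  refine le_trans ?_ hM
  gcongr
  rw [measureReal_def, measureReal_def, Measure.restrict_apply' measurableSet_ball]
  refine ENNReal.toReal_mono (measure_ne_top_of_subset Set.inter_subset_right
    measure_ball_lt_top.ne) (measure_mono ?_)
  rintro t ⟨ht, ht'⟩
  refine ⟨?_, ht⟩
  simp only [dist_zero_right, Real.norm_eq_abs, Set.mem_ofPred_eq, not_lt] at ht'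
  simpa using pow_le_pow_left₀ hε.le ht' 2

/-- Bounded functions which vanish along the density-one filter have vanishing absolute means. The
function need not be measurable. -/
lemma tendsto_average_of_densityOne [(volume : Measure V).IsOpenPosMeasure] {φ : V → ℝ}
    (hb : ∀ t, |φ t| ≤ 1)
    (h : Tendsto φ (densityOne V) (𝓝 0)) :
    Tendsto (fun r : ℝ => (volume.real (Metric.ball (0 : V) r))⁻¹ *
      ∫ t in Metric.ball (0 : V) r, |φ t|) atTop (𝓝 0) := by
  have hnn : ∀ r : ℝ, 0 ≤ (volume.real (Metric.ball (0 : V) r))⁻¹ *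
      ∫ t in Metric.ball (0 : V) r, |φ t| := fun r =>
    mul_nonneg (by positivity) (integral_nonneg fun t => abs_nonneg _)
  rw [Metric.tendsto_nhds]
  intro ε hε
  set S : Set V := {t | |φ t| < ε / 2} with hS
  have hSm : S ∈ densityOne V := by
    have hev := (Metric.tendsto_nhds.1 h) (ε / 2) (by positivity)
    simp only [dist_zero_right, Real.norm_eq_abs] at hev
    exact hev
  filter_upwards [(Metric.tendsto_nhds.1 (mem_densityOne.1 hSm)) (ε / 2) (by positivity),
    eventually_gt_atTop 0] with r hr hr0
  have hV := volume_real_ball_pos (V := V) hr0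
  rw [dist_zero_right, Real.norm_of_nonneg (by positivity)] at hr
  rw [dist_zero_right, Real.norm_of_nonneg (hnn r)]
  set D := toMeasurable volume (Metric.ball (0 : V) r \ S) with hD
  have hDm : MeasurableSet D := measurableSet_toMeasurable _ _
  have hDv : volume D = volume (Metric.ball (0 : V) r \ S) := measure_toMeasurable _
  have hDfin : volume D ≠ ⊤ := by
    rw [hDv]
    exact measure_ne_top_of_subset Set.sdiff_subset measure_ball_lt_top.ne
  have hBfin : volume (Metric.ball (0 : V) r) ≠ ⊤ := measure_ball_lt_top.ne
  have hI1 : IntegrableOn (fun _ : V => ε / 2) (Metric.ball (0 : V) r) :=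
    integrableOn_const hBfin
  have hI3 : Integrable (D.indicator fun _ : V => (1 : ℝ)) :=
    (integrable_indicator_iff hDm).2 (integrableOn_const hDfin)
  have hI2 : IntegrableOn (D.indicator fun _ : V => (1 : ℝ)) (Metric.ball (0 : V) r) :=
    hI3.integrableOn
  have hle : ∫ t in Metric.ball (0 : V) r, |φ t| ≤
      ε / 2 * volume.real (Metric.ball (0 : V) r)
        + volume.real (Metric.ball (0 : V) r \ S) := by
    calc ∫ t in Metric.ball (0 : V) r, |φ t|
        ≤ ∫ t in Metric.ball (0 : V) r, (ε / 2 + D.indicator (fun _ => (1 : ℝ)) t) := by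
          refine integral_mono_of_nonneg (Eventually.of_forall fun t => abs_nonneg _)
            (hI1.add hI2) ?_
          filter_upwards [ae_restrict_mem measurableSet_ball] with t ht
          by_cases hts : t ∈ S
          · have h1 : |φ t| < ε / 2 := hts
            have h2 : 0 ≤ D.indicator (fun _ => (1 : ℝ)) t :=
              Set.indicator_nonneg (fun _ _ => zero_le_one) t
            linarith
          · have h1 : t ∈ D := subset_toMeasurable _ _ ⟨ht, hts⟩
            rw [Set.indicator_of_mem h1]
            linarith [hb t]
      _ = ε / 2 * volume.real (Metric.ball (0 : V) r)
          + ∫ t in Metric.ball (0 : V) r, D.indicator (fun _ => (1 : ℝ)) t := by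
          rw [integral_add hI1 hI2, setIntegral_const, smul_eq_mul, mul_comm]
      _ ≤ ε / 2 * volume.real (Metric.ball (0 : V) r)
          + ∫ t, D.indicator (fun _ => (1 : ℝ)) t := by
          exact add_le_add le_rfl (setIntegral_le_integral hI3
            (Eventually.of_forall fun t => Set.indicator_nonneg (fun _ _ => zero_le_one) t))
      _ = _ := by
          rw [integral_indicator hDm, setIntegral_const, smul_eq_mul, mul_one,
            measureReal_def volume D, hDv, ← measureReal_def]
  calc (volume.real (Metric.ball (0 : V) r))⁻¹ * ∫ t in Metric.ball (0 : V) r, |φ t|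
      ≤ (volume.real (Metric.ball (0 : V) r))⁻¹ * (ε / 2 * volume.real (Metric.ball (0 : V) r)
        + volume.real (Metric.ball (0 : V) r \ S)) := by gcongr
    _ = ε / 2 + (volume.real (Metric.ball (0 : V) r))⁻¹ *
        volume.real (Metric.ball (0 : V) r \ S) := by field_simp
    _ < ε := by linarith

end Density

/-! ### Cosine transforms -/

section CosineTransform

lemma integrable_mul_cos {W : Type*} [MeasurableSpace W] {μ : Measure W} {g φ : W → ℝ}
    (hg : Integrable g μ) (hφ : Measurable φ) :
    Integrable (fun x => g x * Real.cos (φ x)) μ :=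
  hg.mul_bdd (c := 1) (Real.measurable_cos.comp hφ).aestronglyMeasurable
    (Eventually.of_forall fun x => by simpa using Real.abs_cos_le_one _)

variable {V : Type*} [NormedAddCommGroup V] [InnerProductSpace ℝ V] [MeasurableSpace V]
  [BorelSpace V] [FiniteDimensional ℝ V] {μ : Measure V}

lemma continuous_cosTransform {g : V → ℝ} (hg : Integrable g μ) (c : V) :
    Continuous fun t => ∫ x, g x * Real.cos (inner ℝ (t + c) x) ∂μ := by
  refine continuous_of_dominated (bound := fun x => ‖g x‖)
    (fun t => (integrable_mul_cos hg (by fun_prop)).aestronglyMeasurable)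
    (fun t => Eventually.of_forall fun x => ?_) hg.norm
    (Eventually.of_forall fun x => by fun_prop)
  rw [norm_mul]
  exact mul_le_of_le_one_right (norm_nonneg _) (by simpa using Real.abs_cos_le_one _)

end CosineTransform

section RiemannLebesgue

variable {V : Type*} [NormedAddCommGroup V] [InnerProductSpace ℝ V] [MeasurableSpace V]
  [BorelSpace V] [FiniteDimensional ℝ V]

/-- The Riemann–Lebesgue lemma for cosine transforms with a phase. -/
lemma tendsto_integral_mul_cos_add {f : V → ℝ} (hf : Integrable f) (γ : ℝ) :
    Tendsto (fun t => ∫ x, f x * Real.cos (inner ℝ t x + γ)) (Bornology.cobounded V) (𝓝 0) := by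
  have hpi : (-(2 * Real.pi)⁻¹ : ℝ) ≠ 0 := by
    have := Real.pi_pos
    simp [this.ne']
  have hscale : Tendsto (fun t : V => (-(2 * Real.pi)⁻¹ : ℝ) • t) (cocompact V) (cocompact V) :=
    (Homeomorph.smulOfNeZero _ hpi).isClosedEmbedding.tendsto_cocompact
  have hRL := (tendsto_integral_exp_inner_smul_cocompact (V := V)
    (fun x => (f x : ℂ) * Complex.exp (γ * Complex.I))).comp hscale
  have hre := (Complex.continuous_re.tendsto 0).comp hRL
  rw [Metric.cobounded_eq_cocompact]
  refine hre.congr fun t => ?_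
  have hphase : ∀ x : V, (Real.fourierChar (-(inner ℝ x ((-(2 * Real.pi)⁻¹ : ℝ) • t)))) •
      ((f x : ℂ) * Complex.exp (γ * Complex.I))
      = (f x : ℂ) * Complex.exp (((inner ℝ t x + γ : ℝ) : ℂ) * Complex.I) := by
    intro x
    rw [Circle.smul_def, Real.fourierChar_apply, inner_smul_right, smul_eq_mul, real_inner_comm,
      mul_left_comm, ← Complex.exp_add]
    have := Real.pi_pos.ne'
    congr 2
    push_cast
    have : (Real.pi : ℂ) ≠ 0 := by exact_mod_cast this
    field_simp
  simp only [Function.comp_apply, hphase]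
  have hint : Integrable (fun x : V => (f x : ℂ) *
      Complex.exp (((inner ℝ t x + γ : ℝ) : ℂ) * Complex.I)) := by
    refine hf.ofReal.mul_bdd (c := 1) (Continuous.aestronglyMeasurable (by fun_prop))
      (Eventually.of_forall fun x => ?_)
    rw [Complex.norm_exp_ofReal_mul_I]
  refine (integral_re hint).symm.trans (integral_congr_ae (Eventually.of_forall fun x => ?_))
  simp only [RCLike.re_to_complex]
  rw [Complex.re_ofReal_mul, Complex.exp_ofReal_mul_I_re]

/-- The cosine transform of a function integrable against an absolutely continuous measure vanishes
at infinity. -/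
lemma tendsto_cosTransform_of_absolutelyContinuous {μ : Measure V} [SigmaFinite μ]
    (hμ : μ ≪ volume) {g : V → ℝ} (hg : Integrable g μ) (c : V) :
    Tendsto (fun t => ∫ x, g x * Real.cos (inner ℝ (t + c) x) ∂μ) (Bornology.cobounded V)
      (𝓝 0) := by
  have hd := Measure.withDensity_rnDeriv_eq μ volume hμ
  have hfin : ∀ᵐ x, μ.rnDeriv volume x < ⊤ := Measure.rnDeriv_lt_top μ volume
  have hg' : Integrable fun x => (μ.rnDeriv volume x).toReal * g x := by
    rw [← hd] at hg
    exact (integrable_withDensity_iff_integrable_smul' (Measure.measurable_rnDeriv _ _) hfin).1 hg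
  have htrans : Tendsto (fun t : V => t + c) (Bornology.cobounded V) (Bornology.cobounded V) := by
    rw [Metric.cobounded_eq_cocompact]
    exact (Homeomorph.addRight c).isClosedEmbedding.tendsto_cocompact
  refine ((tendsto_integral_mul_cos_add hg' 0).comp htrans).congr fun t => ?_
  conv_rhs => rw [← hd]
  rw [integral_withDensity_eq_integral_toReal_smul (Measure.measurable_rnDeriv _ _) hfin]
  simp [mul_assoc]

/-- Means of an oscillating cosine over large balls vanish, by rescaling to the unit ball and the
Riemann–Lebesgue lemma. -/
lemma tendsto_average_cos {z : V} (hz : z ≠ 0) (γ : ℝ) :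
    Tendsto (fun r : ℝ => (volume.real (Metric.ball (0 : V) r))⁻¹ *
      ∫ t in Metric.ball (0 : V) r, Real.cos (inner ℝ t z + γ)) atTop (𝓝 0) := by
  have hind : Integrable ((Metric.ball (0 : V) 1).indicator fun _ => (1 : ℝ)) :=
    (integrable_indicator_iff measurableSet_ball).2 (integrableOn_const measure_ball_lt_top.ne)
  have hz' : Tendsto (fun r : ℝ => r • z) atTop (Bornology.cobounded V) := by
    rw [← tendsto_norm_atTop_iff_cobounded]
    simp only [norm_smul]
    exact tendsto_norm_atTop_atTop.atTop_mul_const (norm_pos_iff.2 hz)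
  have h := ((tendsto_integral_mul_cos_add hind γ).comp hz').const_mul
    ((volume.real (Metric.ball (0 : V) 1))⁻¹)
  rw [mul_zero] at h
  refine h.congr' ?_
  filter_upwards [eventually_gt_atTop 0] with r hr
  have h1 := Measure.setIntegral_comp_smul_of_pos (volume : Measure V)
    (fun t => Real.cos (inner ℝ t z + γ)) (Metric.ball (0 : V) 1) hr
  rw [smul_unitBall_of_pos hr, smul_eq_mul] at h1
  have h2 : volume.real (Metric.ball (0 : V) r)
      = r ^ Module.finrank ℝ V * volume.real (Metric.ball (0 : V) 1) := by
    rw [measureReal_def, Measure.addHaar_ball_of_pos _ _ hr, ENNReal.toReal_mul,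
      ENNReal.toReal_ofReal (by positivity), measureReal_def]
  have h3 : ∫ x, (Metric.ball (0 : V) 1).indicator (fun _ => (1 : ℝ)) x *
      Real.cos (inner ℝ (r • z) x + γ)
      = ∫ x in Metric.ball (0 : V) 1, Real.cos (inner ℝ (r • x) z + γ) := by
    rw [← integral_indicator measurableSet_ball]
    refine integral_congr_ae (Eventually.of_forall fun x => ?_)
    by_cases hx : x ∈ Metric.ball (0 : V) 1
    · simp only [Set.indicator_of_mem hx, one_mul, inner_smul_left, real_inner_comm]
    · simp only [Set.indicator_of_notMem hx, zero_mul]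
  rw [Function.comp_apply, h3, h1, h2, mul_inv]
  ring

/-- Wiener's lemma: the cosine transform of a measure without atoms vanishes in quadratic mean. -/
lemma tendsto_average_sq_cosTransform {μ : Measure V} [SFinite μ] (hμ : ∀ x, μ {x} = 0)
    {g : V → ℝ} (hg : Integrable g μ) (c : V) :
    Tendsto (fun r : ℝ => (volume.real (Metric.ball (0 : V) r))⁻¹ *
      ∫ t in Metric.ball (0 : V) r, (∫ x, g x * Real.cos (inner ℝ (t + c) x) ∂μ) ^ 2)
      atTop (𝓝 0) := by
  set k : V → V × V → ℝ := fun t p =>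
    Real.cos (inner ℝ (t + c) p.1) * Real.cos (inner ℝ (t + c) p.2) with hk
  have hkc : Continuous (Function.uncurry k) := by
    simp only [hk, Function.uncurry_def]
    fun_prop
  have hk1 : ∀ t p, |k t p| ≤ 1 := fun t p => by
    rw [hk, abs_mul]
    exact mul_le_one₀ (Real.abs_cos_le_one _) (abs_nonneg _) (Real.abs_cos_le_one _)
  have hgg : Integrable (fun p : V × V => g p.1 * g p.2) (μ.prod μ) := hg.mul_prod hg
  -- Fubini's theorem rewrites the quadratic mean as a double integral of the averaged kernel.
  have hfub : ∀ r : ℝ, ∫ t in Metric.ball (0 : V) r,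
      (∫ x, g x * Real.cos (inner ℝ (t + c) x) ∂μ) ^ 2
      = ∫ p, g p.1 * g p.2 * (∫ t in Metric.ball (0 : V) r, k t p) ∂(μ.prod μ) := by
    intro r
    have : IsFiniteMeasure (volume.restrict (Metric.ball (0 : V) r)) :=
      ⟨by simpa using measure_ball_lt_top⟩
    have h1 : ∀ t, (∫ x, g x * Real.cos (inner ℝ (t + c) x) ∂μ) ^ 2
        = ∫ p, g p.1 * g p.2 * k t p ∂(μ.prod μ) := by
      intro t
      rw [sq, ← integral_prod_mul]
      refine integral_congr_ae (Eventually.of_forall fun p => ?_)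
      simp only [hk]
      ring
    simp_rw [h1]
    rw [integral_integral_swap]
    · simp_rw [integral_const_mul]
    · have h2 : Integrable (fun q : V × (V × V) => (1 : ℝ) * (g q.2.1 * g q.2.2))
          ((volume.restrict (Metric.ball (0 : V) r)).prod (μ.prod μ)) :=
        (integrable_const (1 : ℝ)).mul_prod hgg
      simp only [one_mul] at h2
      exact h2.mul_bdd (c := 1) hkc.aestronglyMeasurable
        (Eventually.of_forall fun q => by simpa [Function.uncurry_def] using hk1 q.1 q.2)
  have hkm : ∀ r : ℝ, StronglyMeasurable fun p : V × V =>
      ∫ t in Metric.ball (0 : V) r, k t p := by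
    intro r
    have hsw : Continuous fun q : (V × V) × V => k q.2 q.1 := by
      simp only [hk]
      fun_prop
    exact StronglyMeasurable.integral_prod_right (f := fun (p : V × V) (t : V) => k t p)
      hsw.stronglyMeasurable
  have hlim : Tendsto (fun r : ℝ => ∫ p, g p.1 * g p.2 *
      ((volume.real (Metric.ball (0 : V) r))⁻¹ * ∫ t in Metric.ball (0 : V) r, k t p)
      ∂(μ.prod μ)) atTop (𝓝 (∫ _, (0 : ℝ) ∂(μ.prod μ))) := by
    refine tendsto_integral_filter_of_dominated_convergence
      (fun p : V × V => ‖g p.1 * g p.2‖) ?_ ?_ hgg.norm ?_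
    · refine Eventually.of_forall fun r => ?_
      exact hgg.aestronglyMeasurable.mul ((hkm r).aestronglyMeasurable.const_mul _)
    · refine Eventually.of_forall fun r => Eventually.of_forall fun p => ?_
      rw [norm_mul]
      refine mul_le_of_le_one_right (norm_nonneg _) ?_
      have h1 : ‖∫ t in Metric.ball (0 : V) r, k t p‖ ≤ 1 * volume.real (Metric.ball (0 : V) r) :=
        norm_setIntegral_le_of_norm_le_const measure_ball_lt_top fun t _ => hk1 t p
      rw [norm_mul, norm_inv, Real.norm_of_nonneg measureReal_nonneg]
      rw [one_mul] at h1
      exact (mul_le_mul_of_nonneg_left h1 (by positivity)).trans inv_mul_le_one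
    · have hdiag : ∀ᵐ p ∂(μ.prod μ), p.1 - p.2 ≠ 0 ∧ p.1 + p.2 ≠ 0 := by
        have hm : MeasurableSet {p : V × V | p.1 - p.2 ≠ 0 ∧ p.1 + p.2 ≠ 0} :=
          ((isOpen_ne_fun (by fun_prop) (by fun_prop)).inter
            (isOpen_ne_fun (by fun_prop) (by fun_prop))).measurableSet
        refine (Measure.ae_prod_mem_iff_ae_ae_mem hm).2 (Eventually.of_forall fun x => ?_)
        have h1 : ∀ᵐ y ∂μ, y ≠ x := by simpa [ae_iff] using hμ x
        have h2 : ∀ᵐ y ∂μ, y ≠ -x := by simpa [ae_iff] using hμ (-x)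
        filter_upwards [h1, h2] with y hy1 hy2
        exact ⟨sub_ne_zero.2 hy1.symm, fun h => hy2 (eq_neg_of_add_eq_zero_right h)⟩
      filter_upwards [hdiag] with p hp
      have h1 := (tendsto_average_cos hp.1 (inner ℝ c (p.1 - p.2))).add
        (tendsto_average_cos hp.2 (inner ℝ c (p.1 + p.2)))
      have h2 := (h1.div_const 2).const_mul (g p.1 * g p.2)
      simp only [add_zero, zero_div, mul_zero] at h2
      refine h2.congr fun r => ?_
      have hi : ∀ (z : V) (γ : ℝ), IntegrableOn (fun t : V => Real.cos (inner ℝ t z + γ))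
          (Metric.ball 0 r) := fun z γ =>
        IntegrableOn.of_bound measure_ball_lt_top
          (Continuous.aestronglyMeasurable (by fun_prop)) 1
          (Eventually.of_forall fun t => by simpa using Real.abs_cos_le_one _)
      rw [← mul_add, ← integral_add (hi _ _) (hi _ _), mul_div_assoc, ← integral_div]
      congr 2
      refine integral_congr_ae (Eventually.of_forall fun t => ?_)
      simp only [hk, ← inner_add_left]
      rw [inner_sub_right, inner_add_right, Real.cos_sub, Real.cos_add]
      ring
  rw [integral_zero] at hlim
  refine hlim.congr fun r => ?_
  rw [hfub, ← integral_const_mul]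
  refine integral_congr_ae (Eventually.of_forall fun p => ?_)
  ring

/-- The cosine transform of a measure without atoms vanishes along the density-one filter. -/
lemma tendsto_cosTransform_densityOne {μ : Measure V} [SFinite μ] (hμ : ∀ x, μ {x} = 0)
    {g : V → ℝ} (hg : Integrable g μ) (c : V) :
    Tendsto (fun t => ∫ x, g x * Real.cos (inner ℝ (t + c) x) ∂μ) (densityOne V) (𝓝 0) :=
  tendsto_densityOne_of_sq (fun r =>
    ((continuous_cosTransform hg c).pow 2).continuousOn.integrableOn_compact
    (isCompact_closedBall 0 r) |>.mono_set Metric.ball_subset_closedBall)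
    (tendsto_average_sq_cosTransform hμ hg c)

end RiemannLebesgue

/-! ### Lévy–Khintchine representation without drift -/

section Levy

variable {d : ℕ} {μ : Measure (EuclideanSpace ℝ (Fin d))} {v : EuclideanSpace ℝ (Fin d) → ℝ}

lemma IsLevyMeasure.integrable_min (h : IsLevyMeasure μ) :
    Integrable (fun x => min 1 (‖x‖ ^ 2)) μ := by
  refine ⟨Continuous.aestronglyMeasurable (by fun_prop), ?_⟩
  rw [hasFiniteIntegral_iff_ofReal (Eventually.of_forall fun x => by positivity)]
  exact h.lintegral_lt_top

/-- A Lévy measure is `σ`-finite, since `1 ∧ ‖x‖²` is integrable and positive off the origin. -/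
lemma IsLevyMeasure.sigmaFinite (h : IsLevyMeasure μ) : SigmaFinite μ := by
  have hf := h.integrable_min.aefinStronglyMeasurable
  have h0 := hf.ae_eq_zero_compl
  have hs := hf.sigmaFinite_restrict
  have hmem : ∀ᵐ x ∂μ, x ∈ hf.sigmaFiniteSet := by
    have h1 : ∀ᵐ x ∂μ, x ≠ 0 := by simpa [ae_iff] using h.zero_singleton
    have h2 := (ae_restrict_iff' hf.measurableSet.compl).1 h0
    filter_upwards [h1, h2] with x hx1 hx2
    by_contra hx
    have h3 : min 1 (‖x‖ ^ 2) = 0 := hx2 hx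
    have h4 : 0 < min 1 (‖x‖ ^ 2) := lt_min one_pos (by positivity)
    exact h4.ne' h3
  rw [Measure.restrict_eq_self_of_ae_mem hmem] at hs
  exact hs

lemma IsLevyMeasure.integrable_sin_sq (h : IsLevyMeasure μ) (t : EuclideanSpace ℝ (Fin d)) :
    Integrable (fun x => 4 * Real.sin (inner ℝ t x / 2) ^ 2) μ := by
  refine Integrable.mono' (h.integrable_min.const_mul (4 + ‖t‖ ^ 2))
    (Continuous.aestronglyMeasurable (by fun_prop)) (Eventually.of_forall fun x => ?_)
  rw [Real.norm_of_nonneg (by positivity)]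
  have h1 : Real.sin (inner ℝ t x / 2) ^ 2 ≤ 1 := Real.sin_sq_le_one _
  have h2 : 4 * Real.sin (inner ℝ t x / 2) ^ 2 ≤ ‖t‖ ^ 2 * ‖x‖ ^ 2 := by
    have h3 := Real.abs_sin_le_abs (x := inner ℝ t x / 2)
    have h4 := abs_real_inner_le_norm t x
    have h5 : Real.sin (inner ℝ t x / 2) ^ 2 ≤ (inner ℝ t x / 2) ^ 2 := sq_le_sq.2 h3
    have h6 : (inner ℝ t x) ^ 2 ≤ (‖t‖ * ‖x‖) ^ 2 := by
      rw [← sq_abs]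
      gcongr
    rw [mul_pow] at h6
    linarith
  rcases min_cases 1 (‖x‖ ^ 2) with ⟨h7, h8⟩ | ⟨h7, h8⟩
  · rw [h7]
    nlinarith [sq_nonneg ‖t‖]
  · rw [h7]
    nlinarith [sq_nonneg ‖t‖, sq_nonneg ‖x‖]

lemma IsLevyMeasure.integrable_sin_mul_sin (h : IsLevyMeasure μ)
    (a b : EuclideanSpace ℝ (Fin d)) :
    Integrable (fun x => 4 * Real.sin (inner ℝ a x / 2) * Real.sin (inner ℝ b x / 2)) μ := by
  refine Integrable.mono' ((h.integrable_sin_sq a).add (h.integrable_sin_sq b))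
    (Continuous.aestronglyMeasurable (by fun_prop)) (Eventually.of_forall fun x => ?_)
  simp only [Pi.add_apply]
  rw [Real.norm_eq_abs, abs_le]
  constructor <;> nlinarith [sq_nonneg (Real.sin (inner ℝ a x / 2) + Real.sin (inner ℝ b x / 2)),
    sq_nonneg (Real.sin (inner ℝ a x / 2) - Real.sin (inner ℝ b x / 2)),
    sq_nonneg (Real.sin (inner ℝ a x / 2)), sq_nonneg (Real.sin (inner ℝ b x / 2))]

lemma HasLevyKhintchine.eq_integral_sin_sq (h : HasLevyKhintchine v 0 μ)
    (t : EuclideanSpace ℝ (Fin d)) :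
    v t = ∫ x, 4 * Real.sin (inner ℝ t x / 2) ^ 2 ∂μ := by
  rw [h.eq_integral t, zero_mul, zero_add]
  refine integral_congr_ae (Eventually.of_forall fun x => ?_)
  have h1 := Complex.norm_exp_I_mul_ofReal_sub_one (-(inner ℝ t x))
  simp only
  rw [norm_sub_rev]
  push_cast at h1
  rw [← mul_neg, h1, Real.norm_eq_abs, sq_abs, neg_div, Real.sin_neg]
  ring

/-- The second differences of a variogram without drift form the cosine transform of a signed
measure with density `4 sin (⟪a, x⟫ / 2) sin (⟪b, x⟫ / 2)` with respect to the Lévy measure. -/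
lemma HasLevyKhintchine.second_difference (h : HasLevyKhintchine v 0 μ)
    (a b t : EuclideanSpace ℝ (Fin d)) :
    v (t + a) + v (t - b) - v (t + a - b) - v t
      = 2 * ∫ x, 4 * Real.sin (inner ℝ a x / 2) * Real.sin (inner ℝ b x / 2) *
        Real.cos (inner ℝ (t + (2⁻¹ : ℝ) • (a - b)) x) ∂μ := by
  have hi := h.isLevyMeasure.integrable_sin_sq
  simp only [h.eq_integral_sin_sq]
  rw [← integral_add' (hi _) (hi _), ← integral_sub' ((hi _).add (hi _)) (hi _),
    ← integral_sub' (((hi _).add (hi _)).sub (hi _)) (hi _), ← integral_const_mul]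
  refine integral_congr_ae (Eventually.of_forall fun x => ?_)
  simp only [Pi.add_apply, Pi.sub_apply, inner_add_left, inner_sub_left, inner_smul_left,
    Real.sin_sq_eq_half_sub, RCLike.conj_to_real]
  set T : ℝ := inner ℝ t x
  set α : ℝ := inner ℝ a x
  set β : ℝ := inner ℝ b x
  rw [show 2 * ((T + α) / 2) = (T + 2⁻¹ * (α - β)) + (α / 2 + β / 2) by ring,
    show 2 * ((T - β) / 2) = (T + 2⁻¹ * (α - β)) - (α / 2 + β / 2) by ring,
    show 2 * ((T + α - β) / 2) = (T + 2⁻¹ * (α - β)) + (α / 2 - β / 2) by ring,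
    show 2 * (T / 2) = (T + 2⁻¹ * (α - β)) - (α / 2 - β / 2) by ring,
    Real.cos_add, Real.cos_sub (T + 2⁻¹ * (α - β)), Real.cos_add (T + 2⁻¹ * (α - β)) (α / 2 - β / 2),
    Real.cos_sub (T + 2⁻¹ * (α - β)), Real.cos_add (α / 2), Real.cos_sub (α / 2)]
  ring

end Levy

/-! ### Covariances of shifted coordinates -/

section Covariance

variable {d : ℕ} {ν : Measure (EuclideanSpace ℝ (Fin d) → EuclideanSpace ℝ (Fin d))}

namespace IsGaussianPathLaw

lemma integral_coord_mul_coord (h : IsGaussianPathLaw ν) (s u : EuclideanSpace ℝ (Fin d))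
    (i : Fin d) :
    ∫ w, w s i * w u i ∂ν
      = (∫ w, w s i ^ 2 ∂ν + ∫ w, w u i ^ 2 ∂ν - ∫ w, w (s - u) i ^ 2 ∂ν) / 2 := by
  have h1 := h.integral_sq_sub (coord_mem_pathFunctionals s i) (coord_mem_pathFunctionals u i)
  have h2 := h.integral_comp_incrShift u (f := fun w => w (s - u) i ^ 2)
    ((measurable_of_mem_pathFunctionals (coord_mem_pathFunctionals (s - u) i)).pow_const 2)
  simp only [incrShift, sub_add_cancel, PiLp.sub_apply] at h2
  linarith

lemma integral_shift_coord_mul_coord (h : IsGaussianPathLaw ν)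
    (x y t : EuclideanSpace ℝ (Fin d)) (i : Fin d) :
    ∫ w, (w (x + t) i - w t i) * w y i ∂ν
      = (∫ w, w (t + x) i ^ 2 ∂ν + ∫ w, w (t - y) i ^ 2 ∂ν - ∫ w, w (t + x - y) i ^ 2 ∂ν
        - ∫ w, w t i ^ 2 ∂ν) / 2 := by
  have hx := coord_mem_pathFunctionals (x + t) i
  have ht := coord_mem_pathFunctionals t i
  have hy := coord_mem_pathFunctionals y i
  simp only [sub_mul]
  rw [integral_sub (h.integrable_mul hx hy) (h.integrable_mul ht hy),
    h.integral_coord_mul_coord, h.integral_coord_mul_coord, add_comm x t]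
  ring

lemma integral_shift_coord_mul_coord_eq_cosTransform (h : IsGaussianPathLaw ν) {i : Fin d}
    {μ : Measure (EuclideanSpace ℝ (Fin d))}
    (hμ : HasLevyKhintchine (fun t => ∫ w, w t i ^ 2 ∂ν) 0 μ)
    (x y t : EuclideanSpace ℝ (Fin d)) :
    ∫ w, (w (x + t) i - w t i) * w y i ∂ν
      = ∫ z, 4 * Real.sin (inner ℝ x z / 2) * Real.sin (inner ℝ y z / 2) *
        Real.cos (inner ℝ (t + (2⁻¹ : ℝ) • (x - y)) z) ∂μ := by
  rw [h.integral_shift_coord_mul_coord, hμ.second_difference]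
  ring

lemma koopman_koopman (h : IsGaussianPathLaw ν) (s t : EuclideanSpace ℝ (Fin d))
    (f : Lp ℝ 2 ν) : h.koopman s (h.koopman t f) = h.koopman (t + s) f := by
  refine Lp.ext ?_
  filter_upwards [h.coeFn_koopman s (h.koopman t f), h.coeFn_koopman (t + s) f,
    (h.shift s).quasiMeasurePreserving.ae_eq_comp (h.coeFn_koopman t f)] with w h1 h2 h3
  simp only [Function.comp_apply] at h3
  rw [h1, h2, h3, incrShift_incrShift]

end IsGaussianPathLaw

end Covariance

/-! ### Ergodicity excludes atoms -/

section Ergodic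

lemma sum_sum_mul_cos_sub {ι : Type*} [Fintype ι] (p θ : ι → ℝ) :
    ∑ k, ∑ l, p k * p l * Real.cos (θ k - θ l)
      = (∑ k, p k * Real.cos (θ k)) ^ 2 + (∑ k, p k * Real.sin (θ k)) ^ 2 := by
  rw [sq, sq, Finset.sum_mul_sum, Finset.sum_mul_sum, ← Finset.sum_add_distrib]
  refine Finset.sum_congr rfl fun k _ => ?_
  rw [← Finset.sum_add_distrib]
  refine Finset.sum_congr rfl fun l _ => ?_
  rw [Real.cos_sub]
  ring

lemma one_add_sq_div_four_le_cosh (x : ℝ) :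
    1 + x ^ 2 / 4 ≤ (Real.exp (-x) + Real.exp x) / 2 := by
  wlog hx : 0 ≤ x generalizing x
  · have := this (-x) (by linarith)
    rw [neg_neg, neg_sq] at this
    linarith
  · have h1 := Real.quadratic_le_exp_of_nonneg hx
    have h2 := Real.add_one_le_exp (-x)
    linarith

variable {V : Type*} [NormedAddCommGroup V] [InnerProductSpace ℝ V]

/-- A quadratic form in the values `cos ⟪t_k - t_l, x⟫ cos ⟪t_k - t_l, x₀⟫` is nonnegative, being
half the sum of the forms of the frequencies `x - x₀` and `x + x₀`; at `x = x₀` the first of these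
has frequency zero. -/
lemma sum_sum_mul_cos_mul_cos {ι : Type*} [Fintype ι] (p : ι → ℝ) (t : ι → V) (x x₀ : V) :
    (0 ≤ ∑ k, ∑ l, p k * p l *
      (Real.cos (inner ℝ (t k - t l) x) * Real.cos (inner ℝ (t k - t l) x₀))) ∧
    (∑ k, p k) ^ 2 / 2 ≤ ∑ k, ∑ l, p k * p l *
      (Real.cos (inner ℝ (t k - t l) x₀) * Real.cos (inner ℝ (t k - t l) x₀)) := by
  have key : ∀ x, ∑ k, ∑ l, p k * p l *
      (Real.cos (inner ℝ (t k - t l) x) * Real.cos (inner ℝ (t k - t l) x₀))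
      = (∑ k, ∑ l, p k * p l * Real.cos (inner ℝ (t k) (x - x₀) - inner ℝ (t l) (x - x₀))) / 2
        + (∑ k, ∑ l, p k * p l * Real.cos (inner ℝ (t k) (x + x₀) - inner ℝ (t l) (x + x₀))) / 2 := by
    intro x
    rw [Finset.sum_div, Finset.sum_div, ← Finset.sum_add_distrib]
    refine Finset.sum_congr rfl fun k _ => ?_
    rw [Finset.sum_div, Finset.sum_div, ← Finset.sum_add_distrib]
    refine Finset.sum_congr rfl fun l _ => ?_
    rw [← inner_sub_left, ← inner_sub_left, inner_sub_right, inner_add_right, Real.cos_sub,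
      Real.cos_add]
    ring
  simp only [key, sum_sum_mul_cos_sub]
  refine ⟨by positivity, ?_⟩
  simp only [sub_self, inner_zero_right, Real.cos_zero, Real.sin_zero, mul_one, mul_zero,
    Finset.sum_const_zero]
  have := sq_nonneg (∑ k, p k * Real.cos (inner ℝ (t k) (x₀ + x₀)))
  have := sq_nonneg (∑ k, p k * Real.sin (inner ℝ (t k) (x₀ + x₀)))
  linarith

/-- If the measure with density `g ≥ 0` with respect to `μ` has an atom of mass `m` at `x₀`, then
the quadratic form of the squares `R(t_k - t_l)²` of its cosine transform, evaluated at weights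
`p_k`, is at least `m² / 4`. With `C(t) = cos ⟪t, x₀⟫` this follows from `R² ≥ m R C - m² C² / 4`
and the lower bound `m / 2` for the form of `R C`. -/
lemma sum_sum_mul_sq_cosTransform_ge [MeasurableSpace V] [BorelSpace V] [FiniteDimensional ℝ V]
    {μ : Measure V} {g : V → ℝ} (hg : Integrable g μ) (hg0 : ∀ x, 0 ≤ g x) (x₀ : V)
    {ι : Type*} [Fintype ι] (p : ι → ℝ) (hp : ∀ k, 0 ≤ p k) (hp1 : ∑ k, p k = 1) (t : ι → V) :
    (μ.real {x₀} * g x₀) ^ 2 / 4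
      ≤ ∑ k, ∑ l, p k * p l * (∫ x, g x * Real.cos (inner ℝ (t k - t l) x) ∂μ) ^ 2 := by
  set m := μ.real {x₀} * g x₀ with hm
  set R : ι → ι → ℝ := fun k l => ∫ x, g x * Real.cos (inner ℝ (t k - t l) x) ∂μ with hR
  set C : ι → ι → ℝ := fun k l => Real.cos (inner ℝ (t k - t l) x₀) with hC
  have hi : ∀ k l, Integrable (fun x => g x * Real.cos (inner ℝ (t k - t l) x)) μ := fun k l =>
    integrable_mul_cos hg (by fun_prop)
  have hm0 : 0 ≤ m := mul_nonneg measureReal_nonneg (hg0 _)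
  have h1 : m / 2 ≤ ∑ k, ∑ l, p k * p l * (R k l * C k l) := by
    set q : V → ℝ := fun x => ∑ k, ∑ l, p k * p l *
      (Real.cos (inner ℝ (t k - t l) x) * Real.cos (inner ℝ (t k - t l) x₀)) with hq
    have hgq : (fun x => g x * q x) = fun x => ∑ k, ∑ l, (p k * p l * C k l) *
        (g x * Real.cos (inner ℝ (t k - t l) x)) := by
      ext x
      simp only [hq, Finset.mul_sum, hC]
      exact Finset.sum_congr rfl fun k _ => Finset.sum_congr rfl fun l _ => by ring
    have hgqi : Integrable (fun x => g x * q x) μ := by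
      rw [hgq]
      exact integrable_finsetSum _ fun k _ => integrable_finsetSum _ fun l _ => (hi k l).const_mul _
    have heq : ∫ x, g x * q x ∂μ = ∑ k, ∑ l, p k * p l * (R k l * C k l) := by
      rw [hgq, integral_finsetSum _ fun k _ =>
        integrable_finsetSum _ fun l _ => (hi k l).const_mul _]
      refine Finset.sum_congr rfl fun k _ => ?_
      rw [integral_finsetSum _ fun l _ => (hi k l).const_mul _]
      refine Finset.sum_congr rfl fun l _ => ?_
      rw [integral_const_mul]
      ring
    rw [← heq]
    have hnn : ∀ x, 0 ≤ g x * q x := fun x =>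
      mul_nonneg (hg0 x) (sum_sum_mul_cos_mul_cos p t x x₀).1
    have hq0 : 1 / 2 ≤ q x₀ := by
      have := (sum_sum_mul_cos_mul_cos p t x₀ x₀).2
      rwa [hp1, one_pow] at this
    calc m / 2 = μ.real {x₀} * (g x₀ * (1 / 2)) := by rw [hm]; ring
      _ ≤ μ.real {x₀} * (g x₀ * q x₀) := by
          have := hg0 x₀
          gcongr
      _ = ∫ x in {x₀}, g x * q x ∂μ := by rw [integral_singleton, smul_eq_mul]
      _ ≤ ∫ x, g x * q x ∂μ := setIntegral_le_integral hgqi (Eventually.of_forall hnn)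
  have h2 : ∑ k, ∑ l, p k * p l = 1 := by
    simp_rw [← Finset.mul_sum, hp1, mul_one, hp1]
  calc m ^ 2 / 4 = m * (m / 2) - m ^ 2 / 4 * 1 := by ring
    _ ≤ m * (∑ k, ∑ l, p k * p l * (R k l * C k l)) - m ^ 2 / 4 * ∑ k, ∑ l, p k * p l := by
        rw [h2]
        gcongr
    _ = ∑ k, ∑ l, p k * p l * (m * (R k l * C k l) - m ^ 2 / 4) := by
        simp only [Finset.mul_sum, ← Finset.sum_sub_distrib]
        exact Finset.sum_congr rfl fun k _ => Finset.sum_congr rfl fun l _ => by ring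
    _ ≤ ∑ k, ∑ l, p k * p l * R k l ^ 2 := by
        refine Finset.sum_le_sum fun k _ => Finset.sum_le_sum fun l _ => ?_
        have hpp := mul_nonneg (hp k) (hp l)
        have hC1 : C k l ^ 2 ≤ 1 := Real.cos_sq_le_one _
        gcongr
        nlinarith [sq_nonneg (R k l - m / 2 * C k l), sq_nonneg m]

end Ergodic

section ErgodicAtom

variable {d : ℕ} {ν : Measure (EuclideanSpace ℝ (Fin d) → EuclideanSpace ℝ (Fin d))}

namespace IsGaussianPathLaw

/-- If invariant events are trivial, then so are the invariant vectors of the Koopman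
representation. -/
lemma eq_const_of_fixed (h : IsGaussianPathLaw ν)
    (herg : ∀ A : Set (EuclideanSpace ℝ (Fin d) → EuclideanSpace ℝ (Fin d)), MeasurableSet A →
      (∀ t, ν (symmDiff (incrShift t ⁻¹' A) A) = 0) → ν A = 0 ∨ ν A = 1)
    {f : Lp ℝ 2 ν} (hf : ∀ t, h.koopman t f = f) :
    ∃ c : ℝ, f =ᵐ[ν] fun _ => c := by
  have := h.isProbabilityMeasure
  have hfm : Measurable f := (Lp.stronglyMeasurable f).measurable
  refine exists_eventuallyEq_const_of_forall_separating MeasurableSet fun S hS => ?_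
  have hA : MeasurableSet (f ⁻¹' S) := hfm hS
  have hinv : ∀ t, ν (symmDiff (incrShift t ⁻¹' (f ⁻¹' S)) (f ⁻¹' S)) = 0 := by
    intro t
    rw [measure_symmDiff_eq_zero_iff]
    have h1 := h.coeFn_koopman t f
    rw [hf t] at h1
    filter_upwards [h1] with w hw
    exact propext (show f (incrShift t w) ∈ S ↔ f w ∈ S by rw [hw])
  rcases herg (f ⁻¹' S) hA hinv with h0 | h1
  · exact Or.inr (measure_eq_zero_iff_ae_notMem.1 h0)
  · exact Or.inl ((prob_compl_eq_zero_iff hA).2 h1)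

/-- An atom of the Lévy measure of a coordinate contradicts ergodicity. For `f = cos (B_a)_i` all
convex combinations of the orbit of `f` under the Koopman representation have variance bounded
below, hence so has the fixed vector in the closed convex hull of this orbit. -/
lemma measure_singleton_eq_zero_of_ergodic (h : IsGaussianPathLaw ν)
    (herg : ∀ A : Set (EuclideanSpace ℝ (Fin d) → EuclideanSpace ℝ (Fin d)), MeasurableSet A →
      (∀ t, ν (symmDiff (incrShift t ⁻¹' A) A) = 0) → ν A = 0 ∨ ν A = 1)
    {i : Fin d} {μ : Measure (EuclideanSpace ℝ (Fin d))}
    (hμ : HasLevyKhintchine (fun t => ∫ w, w t i ^ 2 ∂ν) 0 μ)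
    (x₀ : EuclideanSpace ℝ (Fin d)) : μ {x₀} = 0 := by
  have := h.isProbabilityMeasure
  by_contra hatom
  have hx₀ : x₀ ≠ 0 := by
    rintro rfl
    exact hatom hμ.isLevyMeasure.zero_singleton
  -- With this choice of `a` the increment over `a` does not suppress the frequency `x₀`.
  set a : EuclideanSpace ℝ (Fin d) := (Real.pi / ‖x₀‖ ^ 2) • x₀ with ha
  set g : EuclideanSpace ℝ (Fin d) → ℝ := fun z =>
    4 * Real.sin (inner ℝ a z / 2) * Real.sin (inner ℝ a z / 2) with hg
  have hgi : Integrable g μ := hμ.isLevyMeasure.integrable_sin_mul_sin a a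
  have hg0 : ∀ z, 0 ≤ g z := fun z => by
    simp only [hg, mul_assoc]
    exact mul_nonneg (by norm_num) (mul_self_nonneg _)
  have hgx₀ : g x₀ = 4 := by
    have h1 : inner ℝ a x₀ = Real.pi := by
      have : ‖x₀‖ ≠ 0 := norm_ne_zero_iff.2 hx₀
      rw [ha, inner_smul_left, real_inner_self_eq_norm_sq]
      simp
      field_simp
    simp [hg, h1]
  have hfin : μ {x₀} ≠ ⊤ := by
    have h1 := hgi.measure_norm_ge_lt_top (ε := 4) (by norm_num)
    refine (lt_of_le_of_lt (measure_mono ?_) h1).ne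
    rintro _ rfl
    simp [hgx₀]
  set m := μ.real {x₀} * g x₀ with hm
  have hm0 : 0 < m := by
    rw [hm, hgx₀]
    exact mul_pos (ENNReal.toReal_pos hatom hfin) (by norm_num)
  have hX := coord_mem_pathFunctionals a i (E := EuclideanSpace ℝ (Fin d))
  set X : (EuclideanSpace ℝ (Fin d) → EuclideanSpace ℝ (Fin d)) → ℝ := fun w => w a i with hXdef
  set σ := Real.exp (-(∫ w, X w ^ 2 ∂ν) / 2) with hσ
  have hσ0 : 0 < σ := Real.exp_pos _
  set f := cosLp ν (measurable_of_mem_pathFunctionals hX) 0 with hf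
  set e := Lp.const 2 ν (1 : ℝ) with he
  set R : EuclideanSpace ℝ (Fin d) → ℝ := fun t => ∫ x, g x * Real.cos (inner ℝ t x) ∂μ with hR
  have hinner : ∀ s t, inner ℝ (h.koopman s f) (h.koopman t f)
      = σ ^ 2 * ((Real.exp (-R (s - t)) + Real.exp (R (s - t))) / 2) := by
    intro s t
    have h1 : h.koopman s f = h.koopman t (h.koopman (s - t) f) := by
      rw [h.koopman_koopman, sub_add_cancel]
    have h2 : ∫ w, X (incrShift (s - t) w) * X w ∂ν = R (s - t) := by
      have := h.integral_shift_coord_mul_coord_eq_cosTransform hμ a a (s - t)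
      simp only [sub_self, smul_zero, add_zero] at this
      exact this
    rw [h1, LinearIsometry.inner_map_map, h.inner_koopman_cosLp _ hX hX, h2]
    simp only [add_zero, sub_zero, Real.cos_zero, mul_one]
    rw [sq]
  have hmean : ∀ t, inner ℝ (h.koopman t f) e = σ := by
    intro t
    have h1 : h.koopman t f =ᵐ[ν] fun w => Real.cos (X (incrShift t w) + 0) := by
      filter_upwards [h.coeFn_koopman t f, (h.shift t).quasiMeasurePreserving.ae_eq_comp
        (coeFn_cosLp ν (measurable_of_mem_pathFunctionals hX) 0)] with w h1 h2
      rw [h1]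
      exact h2
    have hXm := measurable_of_mem_pathFunctionals hX
    rw [inner_const_one_right h1,
      h.integral_comp_incrShift t (f := fun w => Real.cos (X w + 0)) (by fun_prop),
      integral_cos_add_of_hasGaussianLaw (h.gaussian X hX) (h.centered X hX)]
    simp [hσ]
  obtain ⟨v, hv, hfix⟩ := exists_fixed_mem_closure_convexHull h.koopman f
    (fun s t => h.koopman_koopman s t f)
  have hvmean : inner ℝ v e = σ := by
    have hconv : Convex ℝ {w : Lp ℝ 2 ν | inner ℝ w e = σ} := by
      intro u hu w hw p q _ _ hpq
      simp only [Set.mem_ofPred_eq] at hu hw ⊢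
      rw [inner_add_left, real_inner_smul_left, real_inner_smul_left, hu, hw, ← add_mul, hpq,
        one_mul]
    have hcl : IsClosed {w : Lp ℝ 2 ν | inner ℝ w e = σ} :=
      isClosed_eq (by fun_prop) continuous_const
    refine closure_minimal (convexHull_min ?_ hconv) hcl hv
    rintro _ ⟨t, rfl⟩
    exact hmean t
  have hvnorm : σ ^ 2 * (1 + m ^ 2 / 16) ≤ ‖v‖ ^ 2 := by
    have hcl : IsClosed {w : Lp ℝ 2 ν | σ ^ 2 * (1 + m ^ 2 / 16) ≤ ‖w‖ ^ 2} :=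
      isClosed_le continuous_const (by fun_prop)
    refine closure_minimal ?_ hcl hv
    intro w hw
    obtain ⟨ι, _, p, z, hp, hp1, hz, rfl⟩ := mem_convexHull_iff_exists_fintype.1 hw
    choose t ht using hz
    simp only at ht
    simp only [Set.mem_ofPred_eq, ← ht]
    have hexpand : ‖∑ k, p k • h.koopman (t k) f‖ ^ 2
        = ∑ k, ∑ l, p k * p l *
          (σ ^ 2 * ((Real.exp (-R (t k - t l)) + Real.exp (R (t k - t l))) / 2)) := by
      rw [← real_inner_self_eq_norm_sq, sum_inner]
      refine Finset.sum_congr rfl fun k _ => ?_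
      rw [inner_sum]
      refine Finset.sum_congr rfl fun l _ => ?_
      rw [real_inner_smul_left, real_inner_smul_right, hinner]
      ring
    have hpp : ∑ k, ∑ l, p k * p l = 1 := by
      simp_rw [← Finset.mul_sum, hp1, mul_one, hp1]
    have hlow := sum_sum_mul_sq_cosTransform_ge hgi hg0 x₀ p hp hp1 t
    rw [hexpand]
    calc σ ^ 2 * (1 + m ^ 2 / 16) = σ ^ 2 * (1 + (m ^ 2 / 4) / 4) := by ring
      _ ≤ σ ^ 2 * (∑ k, ∑ l, p k * p l + (∑ k, ∑ l, p k * p l * R (t k - t l) ^ 2) / 4) := by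
          rw [hpp]
          gcongr
      _ = ∑ k, ∑ l, p k * p l * (σ ^ 2 * (1 + R (t k - t l) ^ 2 / 4)) := by
          rw [Finset.sum_div, ← Finset.sum_add_distrib, Finset.mul_sum]
          refine Finset.sum_congr rfl fun k _ => ?_
          rw [Finset.sum_div, ← Finset.sum_add_distrib, Finset.mul_sum]
          exact Finset.sum_congr rfl fun l _ => by ring
      _ ≤ _ := by
          refine Finset.sum_le_sum fun k _ => Finset.sum_le_sum fun l _ => ?_
          have := mul_nonneg (hp k) (hp l)
          gcongr
          exact one_add_sq_div_four_le_cosh _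
  obtain ⟨c, hc⟩ := h.eq_const_of_fixed herg hfix
  have hcσ : c = σ := by
    rw [← hvmean, inner_const_one_right hc]
    simp
  have hnorm : ‖v‖ ^ 2 = σ ^ 2 := by
    rw [← real_inner_self_eq_norm_sq, L2.inner_def, ← hcσ]
    calc ∫ w, inner ℝ (v w) (v w) ∂ν = ∫ _, c ^ 2 ∂ν := by
          refine integral_congr_ae ?_
          filter_upwards [hc] with w hw
          rw [hw]
          simp [sq]
      _ = c ^ 2 := by simp
  rw [hnorm] at hvnorm
  have : 0 < σ ^ 2 * (m ^ 2 / 16) := by positivity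
  linarith

end IsGaussianPathLaw

end ErgodicAtom

/-! ### From the process to its path law -/

section SamplePath

variable {d : ℕ} {Ω : Type*} [MeasurableSpace Ω] {P : Measure Ω}
  {B : EuclideanSpace ℝ (Fin d) → Ω → EuclideanSpace ℝ (Fin d)}

lemma measurable_samplePath (hmeas : ∀ t, Measurable (B t)) : Measurable (samplePath B) :=
  measurable_pi_lambda _ hmeas

lemma hasGaussianLaw_comp_samplePath (hgauss : IsGaussianProcess B P)
    {X : (EuclideanSpace ℝ (Fin d) → EuclideanSpace ℝ (Fin d)) → ℝ}
    (hX : X ∈ pathFunctionals (EuclideanSpace ℝ (Fin d)) d) :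
    HasGaussianLaw (fun ω => X (samplePath B ω)) P := by
  obtain ⟨J, L, hL⟩ := exists_clm_of_mem_pathFunctionals hX
  simp only [hL]
  exact (hgauss.hasGaussianLaw J).map L

lemma isGaussianPathLaw_map [IsProbabilityMeasure P] (hmeas : ∀ t, Measurable (B t))
    (hgauss : IsGaussianProcess B P) (hcent : ∀ t, ∫ ω, B t ω ∂P = 0)
    (hstat : HasStationaryIncrements B P) : IsGaussianPathLaw (P.map (samplePath B)) := by
  have hB := measurable_samplePath hmeas
  refine ⟨fun X hX => ⟨?_⟩, fun X hX => ?_, fun t => ⟨measurable_incrShift t, ?_⟩⟩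
  · rw [Measure.map_map (measurable_of_mem_pathFunctionals hX) hB]
    exact (hasGaussianLaw_comp_samplePath hgauss hX).isGaussian_map
  · rw [integral_map hB.aemeasurable
      (measurable_of_mem_pathFunctionals hX).aestronglyMeasurable]
    induction hX using Submodule.span_induction with
    | mem X hX =>
      obtain ⟨p, rfl⟩ := hX
      have hint : Integrable (B p.1) P := (hgauss.hasGaussianLaw_eval p.1).integrable
      have h1 := (EuclideanSpace.proj p.2 : EuclideanSpace ℝ (Fin d) →L[ℝ] ℝ).integral_comp_comm hint
      rw [hcent] at h1
      simpa [samplePath] using h1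
    | zero => simp
    | add X Y hX hY h1 h2 =>
      simp only [Pi.add_apply]
      rw [integral_add (hasGaussianLaw_comp_samplePath hgauss hX).integrable
        (hasGaussianLaw_comp_samplePath hgauss hY).integrable, h1, h2, add_zero]
    | smul c X hX h1 =>
      simp only [Pi.smul_apply, smul_eq_mul]
      rw [integral_const_mul, h1, mul_zero]
  · rw [Measure.map_map (measurable_incrShift t) hB]
    exact hstat.shift_law t

lemma integral_coord_sq_map [IsProbabilityMeasure P] (hmeas : ∀ t, Measurable (B t))
    (h : IsGaussianPathLaw (P.map (samplePath B))) (t : EuclideanSpace ℝ (Fin d)) (i : Fin d) :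
    ∫ w, w t i ^ 2 ∂(P.map (samplePath B)) = Var[fun ω => B t ω i; P] := by
  have hB := measurable_samplePath hmeas
  have hc := coord_mem_pathFunctionals t i (E := EuclideanSpace ℝ (Fin d))
  have hm := measurable_of_mem_pathFunctionals hc
  have h0 := h.centered _ hc
  rw [integral_map hB.aemeasurable hm.aestronglyMeasurable] at h0
  rw [integral_map hB.aemeasurable (hm.pow_const 2).aestronglyMeasurable]
  exact (variance_of_integral_eq_zero (X := fun ω => B t ω i) (hm.comp hB).aemeasurable h0).symm

lemma hasLevyKhintchine_map [IsProbabilityMeasure P] (hmeas : ∀ t, Measurable (B t))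
    (h : IsGaussianPathLaw (P.map (samplePath B))) {i : Fin d}
    {μ : Measure (EuclideanSpace ℝ (Fin d))}
    (hμ : HasLevyKhintchine (fun t => Var[fun ω => B t ω i; P]) 0 μ) :
    HasLevyKhintchine (fun t => ∫ w, w t i ^ 2 ∂(P.map (samplePath B))) 0 μ := by
  simpa only [integral_coord_sq_map hmeas h] using hμ

lemma integral_shift_coord_mul_coord_of_ne [IsProbabilityMeasure P]
    (hmeas : ∀ t, Measurable (B t))
    (hindep : iIndepFun (fun (i : Fin d) (ω : Ω) (t : EuclideanSpace ℝ (Fin d)) => B t ω i) P)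
    (h : IsGaussianPathLaw (P.map (samplePath B))) (x y t : EuclideanSpace ℝ (Fin d))
    {i j : Fin d} (hij : i ≠ j) :
    ∫ w, (w (x + t) i - w t i) * w y j ∂(P.map (samplePath B)) = 0 := by
  have hB := measurable_samplePath hmeas
  have hcoord : ∀ (s : EuclideanSpace ℝ (Fin d)) (k : Fin d),
      Measurable fun w : EuclideanSpace ℝ (Fin d) → EuclideanSpace ℝ (Fin d) => w s k := fun s k =>
    measurable_of_mem_pathFunctionals (coord_mem_pathFunctionals s k)
  have hmul : ∀ s, ∫ w, w s i * w y j ∂(P.map (samplePath B)) = 0 := by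
    intro s
    have h0 := h.centered _ (coord_mem_pathFunctionals s i)
    rw [integral_map hB.aemeasurable (hcoord s i).aestronglyMeasurable] at h0
    have hInd : IndepFun (fun ω => B s ω i) (fun ω => B y ω j) P :=
      (hindep.indepFun hij).comp (measurable_pi_apply s) (measurable_pi_apply y)
    have h1 := hInd.integral_fun_mul_eq_mul_integral
      ((hcoord s i).comp hB).aestronglyMeasurable ((hcoord y j).comp hB).aestronglyMeasurable
    have hm : Measurable fun w : EuclideanSpace ℝ (Fin d) → EuclideanSpace ℝ (Fin d) =>
      w s i * w y j := (hcoord s i).mul (hcoord y j)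
    rw [integral_map hB.aemeasurable hm.aestronglyMeasurable]
    simp only [samplePath] at h0 ⊢
    rw [h1, h0, zero_mul]
  simp only [sub_mul]
  rw [integral_sub (h.integrable_mul (coord_mem_pathFunctionals _ _)
    (coord_mem_pathFunctionals _ _)) (h.integrable_mul (coord_mem_pathFunctionals _ _)
    (coord_mem_pathFunctionals _ _)), hmul, hmul, sub_zero]

/-- The covariance of a shifted coordinate with another one is half of an entry of a second
difference of the variogram; off the diagonal both vanish by independence. -/
lemma integral_shift_coord_mul_coord_eq_variogramDiff [IsProbabilityMeasure P]
    (hmeas : ∀ t, Measurable (B t))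
    (hindep : iIndepFun (fun (i : Fin d) (ω : Ω) (t : EuclideanSpace ℝ (Fin d)) => B t ω i) P)
    (h : IsGaussianPathLaw (P.map (samplePath B))) (x y t : EuclideanSpace ℝ (Fin d))
    (i j : Fin d) :
    ∫ w, (w (x + t) i - w t i) * w y j ∂(P.map (samplePath B))
      = variogramDiff B P x (-y) t i j / 2 := by
  have hB := measurable_samplePath hmeas
  have hL : ∀ s k, MemLp (fun ω => B s ω k) 2 P := fun s k =>
    (h.memLp_two (coord_mem_pathFunctionals s k)).comp_measurePreserving ⟨hB, rfl⟩
  rcases eq_or_ne i j with rfl | hij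
  · rw [h.integral_shift_coord_mul_coord]
    simp only [integral_coord_sq_map hmeas h, variogramDiff, variogram, Matrix.sub_apply,
      Matrix.add_apply, Matrix.of_apply,
      covariance_self (hL _ _).aestronglyMeasurable.aemeasurable, ← sub_eq_add_neg]
  · have hcov : ∀ s, cov[fun ω => B s ω i, fun ω => B s ω j; P] = 0 := fun s =>
      IndepFun.covariance_eq_zero ((hindep.indepFun hij).comp (measurable_pi_apply s)
        (measurable_pi_apply s)) (hL s i) (hL s j)
    rw [integral_shift_coord_mul_coord_of_ne hmeas hindep h x y t hij]
    simp [variogramDiff, variogram, hcov]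

/-- By independence, decorrelation has to be checked for the two factors in the same coordinate
only, where the covariance is a cosine transform of the Lévy measure. -/
lemma tendsto_integral_shift_coord_mul_coord [IsProbabilityMeasure P]
    (hmeas : ∀ t, Measurable (B t))
    (hindep : iIndepFun (fun (i : Fin d) (ω : Ω) (t : EuclideanSpace ℝ (Fin d)) => B t ω i) P)
    (h : IsGaussianPathLaw (P.map (samplePath B)))
    {μ : Fin d → Measure (EuclideanSpace ℝ (Fin d))}
    (hμ : ∀ i, HasLevyKhintchine (fun t => Var[fun ω => B t ω i; P]) 0 (μ i))
    {l : Filter (EuclideanSpace ℝ (Fin d))}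
    (hl : ∀ i (g : EuclideanSpace ℝ (Fin d) → ℝ) (c : EuclideanSpace ℝ (Fin d)),
      Integrable g (μ i) →
      Tendsto (fun t => ∫ z, g z * Real.cos (inner ℝ (t + c) z) ∂(μ i)) l (𝓝 0))
    (x y : EuclideanSpace ℝ (Fin d)) (i j : Fin d) :
    Tendsto (fun t => ∫ w, (w (x + t) i - w t i) * w y j ∂(P.map (samplePath B))) l (𝓝 0) := by
  rcases eq_or_ne i j with rfl | hij
  · simp only [h.integral_shift_coord_mul_coord_eq_cosTransform
      (hasLevyKhintchine_map hmeas h (hμ i))]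
    exact hl i _ _ ((hμ i).isLevyMeasure.integrable_sin_mul_sin x y)
  · simp only [integral_shift_coord_mul_coord_of_ne hmeas hindep h x y _ hij]
    exact tendsto_const_nhds

lemma measureReal_samplePath_mem (hmeas : ∀ t, Measurable (B t))
    {A : Set (EuclideanSpace ℝ (Fin d) → EuclideanSpace ℝ (Fin d))} (hA : MeasurableSet A) :
    P.real {ω | samplePath B ω ∈ A} = (P.map (samplePath B)).real A := by
  rw [map_measureReal_apply (measurable_samplePath hmeas) hA]
  rfl

lemma measureReal_shiftEvent_inter (hmeas : ∀ t, Measurable (B t))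
    {A A' : Set (EuclideanSpace ℝ (Fin d) → EuclideanSpace ℝ (Fin d))} (hA : MeasurableSet A)
    (hA' : MeasurableSet A') (t : EuclideanSpace ℝ (Fin d)) :
    P.real {ω | samplePath B ω ∈ shiftEvent t A ∧ samplePath B ω ∈ A'}
      = (P.map (samplePath B)).real (incrShift (-t) ⁻¹' A ∩ A') :=
  measureReal_samplePath_mem hmeas ((measurable_incrShift (-t) hA).inter hA')

/-- Mixing is decorrelation of the coordinates at infinity. -/
lemma isMixingProcess_iff [IsProbabilityMeasure P] (hmeas : ∀ t, Measurable (B t))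
    (h : IsGaussianPathLaw (P.map (samplePath B))) :
    IsMixingProcess B P ↔ ∀ x y i j, Tendsto
      (fun t => ∫ w, (w (x + t) i - w t i) * w y j ∂(P.map (samplePath B)))
      (Bornology.cobounded _) (𝓝 0) := by
  rw [← h.tendsto_measureReal_iff]
  have hneg : Tendsto (fun t : EuclideanSpace ℝ (Fin d) => -t) (Bornology.cobounded _)
      (Bornology.cobounded _) := tendsto_neg_cobounded
  refine forall₂_congr fun A A' => forall₂_congr fun hA hA' => ?_
  simp only [measureReal_shiftEvent_inter hmeas hA hA', measureReal_samplePath_mem hmeas hA,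
    measureReal_samplePath_mem hmeas hA', comap_norm_atTop]
  exact ⟨fun hT => (hT.comp hneg).congr fun t => by simp, fun hT => hT.comp hneg⟩

/-! ### Mixing properties of the process -/

/-- Without atoms the covariances vanish along the density-one filter by Wiener's lemma, and so do
the correlations of events. -/
lemma isWeaklyMixingProcess_of_nonatomic [IsProbabilityMeasure P] (hmeas : ∀ t, Measurable (B t))
    (hindep : iIndepFun (fun (i : Fin d) (ω : Ω) (t : EuclideanSpace ℝ (Fin d)) => B t ω i) P)
    (h : IsGaussianPathLaw (P.map (samplePath B)))
    {μ : Fin d → Measure (EuclideanSpace ℝ (Fin d))}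
    (hμ : ∀ i, HasLevyKhintchine (fun t => Var[fun ω => B t ω i; P]) 0 (μ i))
    (hat : ∀ i x, μ i {x} = 0) : IsWeaklyMixingProcess B P := by
  intro A A' hA hA'
  -- Events are moved by `θ_{-t}`, whence the reflection of the density-one filter.
  have hev := (h.tendsto_measureReal_iff (l := map Neg.neg (densityOne _))).2
    (tendsto_integral_shift_coord_mul_coord hmeas hindep h hμ fun i g c hg => by
      have := (hμ i).isLevyMeasure.sigmaFinite
      rw [tendsto_map'_iff]
      refine (tendsto_cosTransform_densityOne (hat i) hg (-c)).congr fun t => ?_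
      refine integral_congr_ae (Eventually.of_forall fun z => ?_)
      simp only
      rw [show -t + c = -(t + -c) by abel, inner_neg_left, Real.cos_neg]) A A' hA hA'
  rw [tendsto_map'_iff] at hev
  have hev' := hev.sub_const ((P.map (samplePath B)).real A * (P.map (samplePath B)).real A')
  rw [sub_self] at hev'
  have := h.isProbabilityMeasure
  have hlim := tendsto_average_of_densityOne (fun t => ?_) hev'
  · simpa only [measureReal_shiftEvent_inter hmeas hA hA', measureReal_samplePath_mem hmeas hA,
      measureReal_samplePath_mem hmeas hA', Function.comp_apply] using hlim
  · have h1 : ∀ S, (P.map (samplePath B)).real S ≤ 1 := fun S => measureReal_le_one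
    have h2 : ∀ S, 0 ≤ (P.map (samplePath B)).real S := fun S => measureReal_nonneg
    have h3 := mul_le_one₀ (h1 A) (h2 A') (h1 A')
    have h4 := mul_nonneg (h2 A) (h2 A')
    rw [Function.comp_apply, abs_le]
    constructor <;> linarith [h1 (incrShift (-t) ⁻¹' A ∩ A'), h2 (incrShift (-t) ⁻¹' A ∩ A')]

/-- For an invariant event of probability `p` the averaged quantity is the constant `|p - p²|`. -/
lemma isErgodicProcess_of_isWeaklyMixingProcess [IsProbabilityMeasure P]
    (hwm : IsWeaklyMixingProcess B P) : IsErgodicProcess B P := by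
  intro A hA hinv
  have hlim := hwm A A hA hA
  have hconst : ∀ t, P.real {ω | samplePath B ω ∈ shiftEvent t A ∧ samplePath B ω ∈ A}
      = P.real {ω | samplePath B ω ∈ A} := by
    intro t
    refine measureReal_congr ?_
    filter_upwards [measure_symmDiff_eq_zero_iff.1 (hinv t)] with ω hω
    have h1 : (samplePath B ω ∈ shiftEvent t A) = (samplePath B ω ∈ A) := hω
    exact propext ⟨fun h => h.2, fun h => ⟨h1 ▸ h, h⟩⟩
  simp only [hconst] at hlim
  set p := P.real {ω | samplePath B ω ∈ A} with hp
  have hev : (fun _ : ℝ => |p - p * p|) =ᶠ[atTop] fun r : ℝ =>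
      (volume.real (Metric.ball (0 : EuclideanSpace ℝ (Fin d)) r))⁻¹ *
        ∫ _ in Metric.ball (0 : EuclideanSpace ℝ (Fin d)) r, |p - p * p| := by
    filter_upwards [eventually_gt_atTop 0] with r hr
    have := volume_real_ball_pos (V := EuclideanSpace ℝ (Fin d)) hr
    rw [setIntegral_const, smul_eq_mul, inv_mul_cancel_left₀ this.ne']
  have h0 : |p - p * p| = 0 := tendsto_nhds_unique tendsto_const_nhds (hlim.congr' hev.symm)
  have h1 : p * (1 - p) = 0 := by
    rw [abs_eq_zero] at h0
    linarith
  rcases mul_eq_zero.1 h1 with h2 | h2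
  · exact Or.inl ((measureReal_eq_zero_iff).1 h2)
  · right
    have h3 : p = 1 := by linarith
    rw [hp, measureReal_def, ENNReal.toReal_eq_one_iff] at h3
    exact h3

lemma measure_singleton_eq_zero_of_isErgodicProcess [IsProbabilityMeasure P]
    (hmeas : ∀ t, Measurable (B t)) (h : IsGaussianPathLaw (P.map (samplePath B)))
    {i : Fin d} {μ : Measure (EuclideanSpace ℝ (Fin d))}
    (hμ : HasLevyKhintchine (fun t => Var[fun ω => B t ω i; P]) 0 μ)
    (herg : IsErgodicProcess B P) (x : EuclideanSpace ℝ (Fin d)) : μ {x} = 0 := by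
  have hB := measurable_samplePath hmeas
  refine h.measure_singleton_eq_zero_of_ergodic (fun A hA hinv => ?_)
    (hasLevyKhintchine_map hmeas h hμ) x
  have hmap : ∀ S : Set (EuclideanSpace ℝ (Fin d) → EuclideanSpace ℝ (Fin d)), MeasurableSet S →
      P.map (samplePath B) S = P {ω | samplePath B ω ∈ S} := fun S hS => Measure.map_apply hB hS
  rw [hmap A hA]
  refine herg A hA fun t => ?_
  have h1 := hinv (-t)
  rwa [hmap _ ((measurable_incrShift (-t) hA).symmDiff hA)] at h1

end SamplePath

theorem theorem2p1 {d : ℕ} {Ω : Type*} [MeasurableSpace Ω]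
    (P : Measure Ω) [IsProbabilityMeasure P]
    (B : EuclideanSpace ℝ (Fin d) → Ω → EuclideanSpace ℝ (Fin d))
    (hmeas : ∀ t, Measurable (B t))
    (hgauss : IsGaussianProcess B P)
    (hcent : ∀ t, ∫ ω, B t ω ∂P = 0)
    (hindep : iIndepFun (fun (i : Fin d) (ω : Ω) (t : EuclideanSpace ℝ (Fin d)) => B t ω i) P)
    (hstat : HasStationaryIncrements B P)
    (μ : Fin d → Measure (EuclideanSpace ℝ (Fin d)))
    (hμ : ∀ i, HasLevyKhintchine (fun t => Var[fun ω => B t ω i; P]) 0 (μ i)) :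
    (IsErgodicProcess B P ↔ ∀ i x, μ i {x} = 0) ∧
    (IsWeaklyMixingProcess B P ↔ ∀ i x, μ i {x} = 0) ∧
    (IsMixingProcess B P ↔
      ∀ a b, Tendsto (fun t => variogramDiff B P a b t) (comap norm atTop) (𝓝 0)) ∧
    ((∀ i, μ i ≪ volume) → IsMixingProcess B P) := by
  have h := isGaussianPathLaw_map hmeas hgauss hcent hstat
  have hE : IsErgodicProcess B P → ∀ i x, μ i {x} = 0 := fun herg i =>
    measure_singleton_eq_zero_of_isErgodicProcess hmeas h (hμ i) herg
  have hW : (∀ i x, μ i {x} = 0) → IsWeaklyMixingProcess B P :=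
    isWeaklyMixingProcess_of_nonatomic hmeas hindep h hμ
  have hWE : IsWeaklyMixingProcess B P → IsErgodicProcess B P :=
    isErgodicProcess_of_isWeaklyMixingProcess
  refine ⟨⟨hE, fun hat => hWE (hW hat)⟩, ⟨fun hwm => hE (hWE hwm), hW⟩, ?_, fun hac => ?_⟩
  · rw [isMixingProcess_iff hmeas h, comap_norm_atTop]
    simp only [integral_shift_coord_mul_coord_eq_variogramDiff hmeas hindep h]
    constructor
    · intro hcov a b
      refine tendsto_pi_nhds.2 fun i => tendsto_pi_nhds.2 fun j => ?_
      have h1 := (hcov a (-b) i j).mul_const 2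
      rw [zero_mul, neg_neg] at h1
      exact h1.congr fun t => by ring
    · intro hV x y i j
      have h1 := tendsto_pi_nhds.1 (tendsto_pi_nhds.1 (hV x (-y)) i) j
      simpa using h1.div_const 2
  · rw [isMixingProcess_iff hmeas h]
    refine tendsto_integral_shift_coord_mul_coord hmeas hindep h hμ fun i g c hg => ?_
    have := (hμ i).isLevyMeasure.sigmaFinite
    exact tendsto_cosTransform_of_absolutelyContinuous (hac i) hg c
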